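/- Let $V:\mathbb R\to\mathbb R$ be differentiable almost everywhere, with derivative $V'$, and consider $$i\partial_t u+\partial_x^2u-Vu=-|u|^4u,\qquad u(0)=u_0,\qquad (t,x)\in\mathbb R\times\mathbb R. \tag{NLS$_V$}$$ A solution on a time interval $I\ni 0$ is a function $u\in C(I;H^1(\mathbb R))$ that satisfies, for all $t\in I$, in the sense of tempered distributions, $$u(t)=e^{it\partial_x^2}u_0+i\int_0^t e^{i(t-s)\partial_x^2}\big(|u|^4u-Vu\big)(s)\,ds .$$ It is the maximal solution on $(T_{\min},T_{\max})$ if every solution with the same initial datum, on any time interval containing $0$, is a restriction of it. The mass and energy are $$M[f]=\|f\|_{L^2}^2,\qquad E_V[f]=\tfrac12\|\partial_xf\|_{L^2}^2+\tfrac12\int_{\mathbb R}V|f|^2\,dx-\tfrac16\|f\|_{L^6}^6 .$$ Fix an odd function $\zeta\in W^{3,\infty}(\mathbb R)$ with $\zeta(s)=2s$ for $|s|\le1$, $\zeta(s)=2[s-(s-1)^3]$ for $1\le s\le 1+1/\sqrt3$, $\zeta(s)=2[s-(s+1)^3]$ for $-1-1/\sqrt3\le s\le-1$, $\zeta'(s)<0$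 for $1+1/\sqrt3<|s|<2$, and $\zeta(s)=0$ for $|s|\ge2$; put $\mathscr X(x)=\int_0^x\zeta(s)\,ds$. Let $u_0\in H^1(\mathbb R)$ and assume: 1. (NLS$_V$) is locally well-posed in $H^1(\mathbb R)$: for every initial datum in $H^1(\mathbb R)$ there is a (necessarily unique) maximal solution $u$ on some $(T_{\min},T_{\max})$ with $-\infty\le T_{\min}<0<T_{\max}\le\infty$; it depends continuously on the initial datum in $C(J;H^1(\mathbb R))$ for each compact interval $J\subset(T_{\min},T_{\max})$; if $T_{\max}<\infty$ (resp. $T_{\min}>-\infty$), then $\|u(t)\|_{H^1}\to\infty$ as $t\nearrow T_{\max}$ (resp. $t\searrow T_{\min}$); and $M[u(t)]$ and $E_V[u(t)]$ are conserved, with $V|u(t)|^2\in L^1(\mathbb R)$. 2. For the maximal solution $u$ with initial datum $u_0$ and every $w(x)=\int_0^x\varphi(s)\,ds$ with $\varphi\in W^{3,\infty}(\mathbb R)$ real-valued and compactly supported, $w'V'|u(t)|^2$ is integrable for all $t\in(T_{\min},T_{\max})$, the function $t\mapsto\int_{\mathbb R} w|u(t,x)|^2dx$ is twice differentiable on $(T_{\min},T_{\max})$,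 and $$\frac{d^2}{dt^2}\int_{\mathbb R} w|u|^2dx=4\int_{\mathbb R} w''|\partial_xu|^2dx-\frac43\int_{\mathbb R} w''|u|^6dx-\int_{\mathbb R} w^{(4)}|u|^2dx-2\int_{\mathbb R} w'V'|u|^2dx .$$ 3. For every $R>0$ and almost every $x\in\mathbb R$, $$-R\,\mathscr X'\!\left(\frac xR\right)V'(x)-4V(x)\le0 .$$ If $E_V[u_0]<0$, then the maximal solution $u$ with initial datum $u_0$ blows up in finite time in both time directions: $T_{\min}>-\infty$, $T_{\max}<\infty$, and $\|u(t)\|_{H^1}\to\infty$ as $t\nearrow T_{\max}$ and as $t\searrow T_{\min}$. -/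

import Mathlib

open MeasureTheory Filter Topology Set
open scoped SchwartzMap ContDiff ENNReal

noncomputable section

namespace NLS

/-! ### Sobolev spaces on the line -/

/-- `g` is the weak (distributional) derivative of `f` on `ℝ`. -/
structure HasWeakDeriv {E : Type*} [NormedAddCommGroup E] [NormedSpace ℝ E]
    (f g : ℝ → E) : Prop where
  locallyIntegrable : LocallyIntegrable f
  locallyIntegrable_deriv : LocallyIntegrable g
  integral_eq : ∀ ψ : ℝ → ℝ, ContDiff ℝ ∞ ψ → HasCompactSupport ψ →
    ∫ x, deriv ψ x • f x = -∫ x, ψ x • g x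

open Classical in
/-- The weak derivative `∂ₓ f` of a complex-valued function (unique up to null sets when it exists;
`0` if there is none). -/
def weakDeriv (f : ℝ → ℂ) : ℝ → ℂ :=
  if h : ∃ g, HasWeakDeriv f g then h.choose else 0

/-- `f ∈ H¹(ℝ)`: `f` and its weak derivative are in `L²(ℝ)`. -/
def MemH1 (f : ℝ → ℂ) : Prop :=
  MemLp f 2 ∧ ∃ g, HasWeakDeriv f g ∧ MemLp g 2

/-- The `H¹(ℝ)` norm. -/
def h1Norm (f : ℝ → ℂ) : ℝ :=
  √((∫ x, ‖f x‖ ^ 2) + ∫ x, ‖weakDeriv f x‖ ^ 2)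

/-- `φ ∈ W^{3,∞}(ℝ)` with weak derivatives `φ' = φ₁`, `φ'' = φ₂`, `φ''' = φ₃`. -/
structure IsW3Inf (φ φ₁ φ₂ φ₃ : ℝ → ℝ) : Prop where
  memLp : MemLp φ ∞
  memLp₁ : MemLp φ₁ ∞
  memLp₂ : MemLp φ₂ ∞
  memLp₃ : MemLp φ₃ ∞
  deriv₁ : HasWeakDeriv φ φ₁
  deriv₂ : HasWeakDeriv φ₁ φ₂
  deriv₃ : HasWeakDeriv φ₂ φ₃

/-! ### The free Schrödinger group -/

/-- The symbol of `e^{iτ∂ₓ²}` for the Fourier transform `∫ e^{-2πixξ} f(x) dx`. -/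
def freeSymbol (τ : ℝ) (ξ : ℝ) : ℂ :=
  Complex.exp (((-(4 * Real.pi ^ 2 * τ) * ξ ^ 2 : ℝ) : ℂ) * Complex.I)

theorem hasTemperateGrowth_exp_mul_I :
    (fun x : ℝ => Complex.exp ((x : ℂ) * Complex.I)).HasTemperateGrowth := by
  have key : ∀ n : ℕ, iteratedDeriv n (fun x : ℝ => Complex.exp ((x : ℂ) * Complex.I)) =
      fun x : ℝ => Complex.I ^ n * Complex.exp ((x : ℂ) * Complex.I) := by
    intro n
    induction n with
    | zero => ext x; simp
    | succ n ih =>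
      rw [iteratedDeriv_succ, ih]
      ext x
      have h : HasDerivAt (fun x : ℝ => Complex.exp ((x : ℂ) * Complex.I))
          (Complex.exp ((x : ℂ) * Complex.I) * (1 * Complex.I)) x :=
        ((Complex.ofRealCLM.hasDerivAt (x := x)).mul_const Complex.I).cexp
      rw [(h.const_mul (Complex.I ^ n)).deriv]
      ring
  refine ⟨(Complex.ofRealCLM.contDiff.mul contDiff_const).cexp, fun n => ⟨0, 1, fun x => ?_⟩⟩
  rw [norm_iteratedFDeriv_eq_norm_iteratedDeriv, key]
  simp [Complex.norm_exp_ofReal_mul_I]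

/-- The symbol is an admissible Fourier multiplier on Schwartz functions. -/
theorem hasTemperateGrowth_freeSymbol (τ : ℝ) : (freeSymbol τ).HasTemperateGrowth := by
  have h : (fun ξ : ℝ => -(4 * Real.pi ^ 2 * τ) * ξ ^ 2).HasTemperateGrowth :=
    (Function.HasTemperateGrowth.const _).mul (Function.HasTemperateGrowth.id'.pow 2)
  exact hasTemperateGrowth_exp_mul_I.comp h

/-- The free Schrödinger group `e^{iτ∂ₓ²}` on Schwartz functions. -/
def freeGroup (τ : ℝ) : 𝓢(ℝ, ℂ) →L[ℂ] 𝓢(ℝ, ℂ) :=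
  SchwartzMap.fourierMultiplierCLM ℂ (freeSymbol τ)

/-! ### Solutions of `i∂ₜu + ∂ₓ²u - Vu = -|u|⁴u` -/

/-- The term `|f|⁴f - Vf`. -/
def forcing (V : ℝ → ℝ) (f : ℝ → ℂ) (x : ℝ) : ℂ :=
  (‖f x‖ : ℂ) ^ 4 * f x - (V x : ℂ) * f x

/-- `u` is a solution on the time interval `I ∋ 0` with initial datum `u₀`: `u ∈ C(I; H¹(ℝ))`
(hence `u` is also bounded in `H¹` on compact subintervals), and
`u(t) = e^{it∂ₓ²}u₀ + i∫₀ᵗ e^{i(t-s)∂ₓ²}(|u|⁴u - Vu)(s) ds` for all `t ∈ I`. The formula is an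
identity of tempered distributions, in which `e^{iτ∂ₓ²}` acts on distributions by
`⟨e^{iτ∂ₓ²}F, ψ⟩ = ⟨F, e^{iτ∂ₓ²}ψ⟩`. -/
structure IsSolution (V : ℝ → ℝ) (u₀ : ℝ → ℂ) (I : Set ℝ) (u : ℝ → ℝ → ℂ) : Prop where
  ordConnected : I.OrdConnected
  zero_mem : (0 : ℝ) ∈ I
  memH1 : ∀ t ∈ I, MemH1 (u t)
  continuous : ∀ t₀ ∈ I,
    Tendsto (fun t => h1Norm (fun x => u t x - u t₀ x)) (𝓝[I] t₀) (𝓝 0)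
  integrable_forcing : ∀ s ∈ I, ∀ ψ : 𝓢(ℝ, ℂ), Integrable (fun x => forcing V (u s) x * ψ x)
  intervalIntegrable_forcing : ∀ t ∈ I, ∀ ψ : 𝓢(ℝ, ℂ),
    IntervalIntegrable (fun s => ∫ x, forcing V (u s) x * freeGroup (t - s) ψ x) volume 0 t
  duhamel : ∀ t ∈ I, ∀ ψ : 𝓢(ℝ, ℂ),
    ∫ x, u t x * ψ x =
      (∫ x, u₀ x * freeGroup t ψ x) +
        Complex.I * ∫ s in (0 : ℝ)..t, ∫ x, forcing V (u s) x * freeGroup (t - s) ψ x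

/-- The open time interval `(Tmin, Tmax)` with possibly infinite end points. -/
def timeInterval (Tmin Tmax : EReal) : Set ℝ :=
  {t | Tmin < (t : EReal) ∧ (t : EReal) < Tmax}

/-- `u`, defined on `(Tmin, Tmax)`, is the maximal solution with initial datum `u₀`: it is a
solution, and every solution with initial datum `u₀`, on any time interval, is a restriction
of it. -/
structure IsMaximalSolution (V : ℝ → ℝ) (u₀ : ℝ → ℂ) (Tmin Tmax : EReal) (u : ℝ → ℝ → ℂ) :
    Prop where
  isSolution : IsSolution V u₀ (timeInterval Tmin Tmax) u
  unique : ∀ (J : Set ℝ) (v : ℝ → ℝ → ℂ), IsSolution V u₀ J v →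
    J ⊆ timeInterval Tmin Tmax ∧ ∀ t ∈ J, v t =ᵐ[volume] u t

/-- The `H¹` norm tends to infinity as `t ↗ Tmax`. -/
def NormBlowsUpAtMax (Tmax : EReal) (u : ℝ → ℝ → ℂ) : Prop :=
  Tendsto (fun t => h1Norm (u t)) (𝓝[<] Tmax.toReal) atTop

/-- The `H¹` norm tends to infinity as `t ↘ Tmin`. -/
def NormBlowsUpAtMin (Tmin : EReal) (u : ℝ → ℝ → ℂ) : Prop :=
  Tendsto (fun t => h1Norm (u t)) (𝓝[>] Tmin.toReal) atTop

/-- The mass `M[f] = ‖f‖²_{L²}`. -/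
def mass (f : ℝ → ℂ) : ℝ := ∫ x, ‖f x‖ ^ 2

/-- The energy `E_V[f] = ½‖∂ₓf‖²_{L²} + ½∫ V|f|² - ⅙‖f‖⁶_{L⁶}`. -/
def energy (V : ℝ → ℝ) (f : ℝ → ℂ) : ℝ :=
  1 / 2 * (∫ x, ‖weakDeriv f x‖ ^ 2) + 1 / 2 * (∫ x, V x * ‖f x‖ ^ 2)
    - 1 / 6 * ∫ x, ‖f x‖ ^ 6

/-- Local well-posedness of the equation in `H¹(ℝ)`: for every `u₀ ∈ H¹(ℝ)` there is a unique
maximal solution, which depends continuously on the initial datum on compact time intervals,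
satisfies the blow-up alternative, and conserves mass and energy (whose potential term is
finite). -/
def LocallyWellPosed (V : ℝ → ℝ) : Prop :=
  ∀ u₀ : ℝ → ℂ, MemH1 u₀ → ∃ (Tmin Tmax : EReal) (u : ℝ → ℝ → ℂ),
    IsMaximalSolution V u₀ Tmin Tmax u ∧
    (∀ a b : ℝ, Icc a b ⊆ timeInterval Tmin Tmax → ∀ ε > 0, ∃ δ > 0, ∀ v₀ : ℝ → ℂ, MemH1 v₀ →
      h1Norm (fun x => v₀ x - u₀ x) < δ → ∀ (Smin Smax : EReal) (v : ℝ → ℝ → ℂ),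
        IsMaximalSolution V v₀ Smin Smax v →
          Icc a b ⊆ timeInterval Smin Smax ∧
            ∀ t ∈ Icc a b, h1Norm (fun x => v t x - u t x) < ε) ∧
    (Tmin ≠ ⊥ → NormBlowsUpAtMin Tmin u) ∧
    (Tmax ≠ ⊤ → NormBlowsUpAtMax Tmax u) ∧
    ∀ t ∈ timeInterval Tmin Tmax,
      mass (u t) = mass u₀ ∧
      Integrable (fun x => V x * ‖u t x‖ ^ 2) ∧
      energy V (u t) = energy V u₀

/-- The solution blows up: it exists only for finite time, in both time directions, and its `H¹`
norm tends to infinity at both ends of its life span. -/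
def BlowsUp (Tmin Tmax : EReal) (u : ℝ → ℝ → ℂ) : Prop :=
  (Tmin ≠ ⊥ ∧ NormBlowsUpAtMin Tmin u) ∧ (Tmax ≠ ⊤ ∧ NormBlowsUpAtMax Tmax u)

/-! ### The localized virial identity -/

/-- The localized virial quantity `I_w(t) = ∫ w |u(t)|² dx` with `w(x) = ∫₀ˣ φ`. -/
def virial (φ : ℝ → ℝ) (u : ℝ → ℝ → ℂ) (t : ℝ) : ℝ :=
  ∫ x, (∫ s in (0 : ℝ)..x, φ s) * ‖u t x‖ ^ 2

/-- The localized virial identity for `u` on the open time interval `I`, for all weights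
`w(x) = ∫₀ˣ φ` with `φ ∈ W^{3,∞}(ℝ)` compactly supported; here `w' = φ`, `w'' = φ₁` and
`w⁗ = φ₃`. It includes that `I_w` is twice differentiable and that the term with `V'` is
integrable. -/
def LocalizedVirialIdentity (V : ℝ → ℝ) (I : Set ℝ) (u : ℝ → ℝ → ℂ) : Prop :=
  ∀ φ φ₁ φ₂ φ₃ : ℝ → ℝ, IsW3Inf φ φ₁ φ₂ φ₃ → HasCompactSupport φ → ∀ t ∈ I,
    Integrable (fun x => φ x * deriv V x * ‖u t x‖ ^ 2) ∧
    DifferentiableAt ℝ (virial φ u) t ∧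
    HasDerivAt (deriv (virial φ u))
      (4 * (∫ x, φ₁ x * ‖weakDeriv (u t) x‖ ^ 2)
        - 4 / 3 * (∫ x, φ₁ x * ‖u t x‖ ^ 6)
        - (∫ x, φ₃ x * ‖u t x‖ ^ 2)
        - 2 * ∫ x, φ x * deriv V x * ‖u t x‖ ^ 2) t

/-! ### The cut-off weight -/

/-- `ζ ∈ W^{3,∞}(ℝ)` is one of the odd cut-offs of the identity used to build the weight `𝒳`. -/
structure IsCutoffProfile (ζ : ℝ → ℝ) : Prop where
  memW3Inf : ∃ ζ₁ ζ₂ ζ₃ : ℝ → ℝ, IsW3Inf ζ ζ₁ ζ₂ ζ₃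
  odd : ∀ s, ζ (-s) = -ζ s
  eq_linear : ∀ s, |s| ≤ 1 → ζ s = 2 * s
  eq_pos : ∀ s, 1 ≤ s → s ≤ 1 + 1 / √3 → ζ s = 2 * (s - (s - 1) ^ 3)
  eq_neg : ∀ s, -1 - 1 / √3 ≤ s → s ≤ -1 → ζ s = 2 * (s - (s + 1) ^ 3)
  deriv_neg : ∀ s, 1 + 1 / √3 < |s| → |s| < 2 → deriv ζ s < 0
  eq_zero : ∀ s, 2 ≤ |s| → ζ s = 0

/-- The weight `𝒳(x) = ∫₀ˣ ζ(s) ds`. -/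
def cutoffWeight (ζ : ℝ → ℝ) (x : ℝ) : ℝ := ∫ s in (0 : ℝ)..x, ζ s

end NLS

end

/-!
The argument is that of Ogawa and Tsutsumi. For `φ = R ζ(· / R)` the weight `w = ∫ φ` equals `x²`
on `|x| ≤ R` and is constant for `|x| ≥ 2 R`. Writing `w'' = 2 - (2 - w'')` and using the sign
condition on `V`, the virial identity bounds the second derivative of `∫ w |u|²` by `16` times the
energy plus an error supported in `|x| ≥ R`: a negative kinetic term `-4 ∫ (2 - w'') |∂ₓu|²`, the
sextic term `4/3 ∫ (2 - w'') |u|⁶` and a remainder of size `R⁻²`. Since `2 - w''` is comparable to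
the square of a Lipschitz function, a localized Sobolev inequality absorbs the sextic term into
the kinetic one as long as the mass in `|x| ≥ R` is small, hence as long as `∫ w |u|²` is below a
small multiple of `R²`. In that regime `∫ w |u|²` is uniformly concave in time.

For `R` large the virial quantity and its derivative at time `0`, divided by `R²`, are so small that
the resulting concave parabola never leaves the regime; the nonnegative virial quantity would
therefore become negative if the solution existed for all positive or all negative times.

The first derivative of the virial quantity is not part of the virial identity. It is computed from
Duhamel's formula: paired with a fixed `H¹` function of compact support, the solution is
differentiable in time, and `∫ w |u(t) - u(t₀)|²` has a minimum at `t₀`.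
-/

namespace NLS

section Primitive

theorem intervalIntegrable_of_locallyIntegrable {E : Type*} [NormedAddCommGroup E] {g : ℝ → E}
    (hg : LocallyIntegrable g) (a b : ℝ) :
    IntervalIntegrable g volume a b :=
  intervalIntegrable_iff.mpr
    ((hg.integrableOn_isCompact isCompact_uIcc).mono_set uIoc_subset_uIcc)

variable {E F : Type*} [NormedAddCommGroup E] [NormedSpace ℝ E] [NormedAddCommGroup F]
  [NormedSpace ℝ F] {f g h k : ℝ → E}

/-- `f` is a primitive of the locally integrable function `g`, i.e. `f` is locally absolutely
continuous with a.e. derivative `g`. -/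
structure IsPrimitive (f g : ℝ → E) : Prop where
  locallyIntegrable : LocallyIntegrable g
  sub_eq : ∀ x y, f y - f x = ∫ t in x..y, g t

theorem isPrimitive_intervalIntegral (hg : LocallyIntegrable g) (a : ℝ) :
    IsPrimitive (fun x => ∫ t in a..x, g t) g :=
  ⟨hg, fun _ _ => intervalIntegral.integral_interval_sub_left
    (intervalIntegrable_of_locallyIntegrable hg _ _)
    (intervalIntegrable_of_locallyIntegrable hg _ _)⟩

namespace IsPrimitive

theorem intervalIntegrable (hf : IsPrimitive f g) (a b : ℝ) : IntervalIntegrable g volume a b :=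
  intervalIntegrable_of_locallyIntegrable hf.locallyIntegrable a b

theorem eq_add_intervalIntegral (hf : IsPrimitive f g) (a : ℝ) :
    f = fun x => f a + ∫ t in a..x, g t :=
  funext fun x => by rw [← hf.sub_eq]; abel

theorem continuous (hf : IsPrimitive f g) : Continuous f := by
  rw [hf.eq_add_intervalIntegral 0]
  exact continuous_const.add (intervalIntegral.continuous_primitive hf.intervalIntegrable 0)

theorem absolutelyContinuousOnInterval (hf : IsPrimitive f g) (a b : ℝ) :
    AbsolutelyContinuousOnInterval f a b := by
  have hn : LocallyIntegrable (fun x => ‖g x‖) := hf.locallyIntegrable.mono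
    hf.locallyIntegrable.aestronglyMeasurable.norm (Eventually.of_forall fun x => by simp)
  refine squeeze_zero (fun _ => Finset.sum_nonneg fun _ _ => dist_nonneg)
    (fun D => Finset.sum_le_sum fun i _ => ?_)
    ((intervalIntegrable_of_locallyIntegrable hn a b
      ).absolutelyContinuousOnInterval_intervalIntegral (c := a) left_mem_uIcc)
  rw [dist_comm, dist_eq_norm, hf.sub_eq, dist_comm, Real.dist_eq,
    (isPrimitive_intervalIntegral hn a).sub_eq]
  exact intervalIntegral.norm_integral_le_abs_integral_norm

theorem sub (hf : IsPrimitive f g) (hh : IsPrimitive h k) :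
    IsPrimitive (fun x => f x - h x) (fun x => g x - k x) := by
  refine ⟨hf.locallyIntegrable.sub hh.locallyIntegrable, fun x y => ?_⟩
  rw [intervalIntegral.integral_sub (hf.intervalIntegrable x y) (hh.intervalIntegrable x y),
    ← hf.sub_eq, ← hh.sub_eq]
  abel

theorem tendsto_zero (hf : IsPrimitive f g) (hfi : Integrable f) (hgi : Integrable g) :
    Tendsto f atTop (𝓝 0) ∧ Tendsto f atBot (𝓝 0) := by
  have hTop : Tendsto f atTop (𝓝 (f 0 + ∫ t in Ioi 0, g t)) := by
    nth_rw 1 [hf.eq_add_intervalIntegral 0]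
    exact (intervalIntegral_tendsto_integral_Ioi 0 hgi.integrableOn tendsto_id).const_add _
  have hBot : Tendsto f atBot (𝓝 (f 0 - ∫ t in Iic 0, g t)) := by
    nth_rw 1 [hf.eq_add_intervalIntegral 0]
    simp only [sub_eq_add_neg, intervalIntegral.integral_symm _ (0 : ℝ)]
    exact (intervalIntegral_tendsto_integral_Iic 0 hgi.integrableOn tendsto_id).neg.const_add _
  rw [IntegrableAtFilter.eq_zero_of_tendsto (hfi.integrableAtFilter _) (fun s hs => ?_) hTop]
    at hTop
  · rw [IntegrableAtFilter.eq_zero_of_tendsto (hfi.integrableAtFilter _) (fun s hs => ?_) hBot]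
      at hBot
    · exact ⟨hTop, hBot⟩
    · obtain ⟨b, hb⟩ := mem_atBot_sets.1 hs
      exact top_le_iff.mp (Real.volume_Iic (a := b) ▸ measure_mono hb)
  · obtain ⟨b, hb⟩ := mem_atTop_sets.1 hs
    exact top_le_iff.mp (Real.volume_Ici (a := b) ▸ measure_mono hb)

theorem integral_Iic_eq (hf : IsPrimitive f g) (hfi : Integrable f) (hgi : Integrable g) (x : ℝ) :
    ∫ t in Iic x, g t = f x := by
  have h1 := intervalIntegral_tendsto_integral_Iic x hgi.integrableOn tendsto_id
  have h2 : Tendsto (fun y => f x - f y) atBot (𝓝 (f x - 0)) :=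
    (hf.tendsto_zero hfi hgi).2.const_sub _
  simp only [hf.sub_eq, sub_zero] at h2
  exact tendsto_nhds_unique h1 h2

theorem integral_Ioi_eq (hf : IsPrimitive f g) (hfi : Integrable f) (hgi : Integrable g) (x : ℝ) :
    ∫ t in Ioi x, g t = -f x := by
  have h1 := intervalIntegral_tendsto_integral_Ioi x hgi.integrableOn tendsto_id
  have h2 : Tendsto (fun y => f y - f x) atTop (𝓝 (0 - f x)) :=
    (hf.tendsto_zero hfi hgi).1.sub_const _
  simp only [hf.sub_eq, zero_sub] at h2
  exact tendsto_nhds_unique h1 h2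

theorem integral_eq_zero (hf : IsPrimitive f g) (hfi : Integrable f) (hgi : Integrable g) :
    ∫ x, g x = 0 := by
  rw [← integral_add_compl measurableSet_Iic hgi, compl_Iic, hf.integral_Iic_eq hfi hgi 0,
    hf.integral_Ioi_eq hfi hgi, add_neg_cancel]

theorem two_mul_norm_le_integral_norm (hf : IsPrimitive f g) (hfi : Integrable f)
    (hgi : Integrable g) (x : ℝ) : 2 * ‖f x‖ ≤ ∫ y, ‖g y‖ := by
  have hIic : ‖f x‖ ≤ ∫ y in Iic x, ‖g y‖ :=
    hf.integral_Iic_eq hfi hgi x ▸ norm_integral_le_integral_norm g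
  have hIoi : ‖f x‖ ≤ ∫ y in Ioi x, ‖g y‖ := by
    rw [← norm_neg, ← hf.integral_Ioi_eq hfi hgi x]
    exact norm_integral_le_integral_norm g
  rw [← integral_add_compl measurableSet_Iic hgi.norm, compl_Iic]
  linarith

variable [CompleteSpace E]

theorem of_hasDerivAt (hd : ∀ x, HasDerivAt f (g x) x) (hg : Continuous g) : IsPrimitive f g :=
  ⟨hg.locallyIntegrable, fun x y => (intervalIntegral.integral_eq_sub_of_hasDerivAt
    (fun t _ => hd t) (hg.intervalIntegrable x y)).symm⟩

theorem of_contDiff (hf : ContDiff ℝ 1 f) : IsPrimitive f (deriv f) :=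
  of_hasDerivAt (fun x => (hf.differentiable one_ne_zero x).hasDerivAt) (hf.continuous_deriv le_rfl)

theorem ae_hasDerivAt (hf : IsPrimitive f g) : ∀ᵐ x, HasDerivAt f (g x) x := by
  rw [hf.eq_add_intervalIntegral 0]
  filter_upwards [LocallyIntegrable.ae_hasDerivAt_integral hf.locallyIntegrable] with x hx
  exact (hx 0).const_add _

theorem of_absolutelyContinuous (hg : LocallyIntegrable g)
    (hf : ∀ a b, AbsolutelyContinuousOnInterval f a b) (hd : ∀ᵐ x, HasDerivAt f (g x) x) :
    IsPrimitive f g := by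
  refine ⟨hg, fun a b => ?_⟩
  have hG := isPrimitive_intervalIntegral hg a
  obtain ⟨C, hC⟩ := ((hf a b).fun_sub
    (hG.absolutelyContinuousOnInterval a b)).const_of_ae_hasDerivAt_zero (by
      filter_upwards [hd, hG.ae_hasDerivAt] with x h1 h2 _
      simpa only [sub_self] using h1.fun_sub h2)
  have ha := hC a left_mem_uIcc
  simp only [intervalIntegral.integral_same, sub_zero] at ha
  rw [ha, ← hC b right_mem_uIcc]
  abel

theorem clm_comp [CompleteSpace F] (hf : IsPrimitive f g) (L : E →L[ℝ] F) :
    IsPrimitive (fun x => L (f x)) (fun x => L (g x)) := by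
  refine ⟨fun x => ?_, fun x y => ?_⟩
  · obtain ⟨s, hs, hi⟩ := hf.locallyIntegrable x
    exact ⟨s, hs, L.integrable_comp hi⟩
  · rw [← map_sub, hf.sub_eq, L.intervalIntegral_comp_comm (hf.intervalIntegrable x y)]

theorem smul {𝕜 : Type*} [RCLike 𝕜] [NormedSpace 𝕜 E] [IsScalarTower ℝ 𝕜 E] {p q : ℝ → 𝕜}
    (hp : IsPrimitive p q) (hf : IsPrimitive f g) :
    IsPrimitive (fun x => p x • f x) (fun x => p x • g x + q x • f x) := by
  refine of_absolutelyContinuous ?_ (fun a b =>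
    (hp.absolutelyContinuousOnInterval a b).fun_smul (hf.absolutelyContinuousOnInterval a b)) ?_
  · rw [← locallyIntegrableOn_univ]
    exact (hf.locallyIntegrable.locallyIntegrableOn _ |>.continuousOn_smul
        isOpen_univ.isLocallyClosed hp.continuous.continuousOn).add
      (hp.locallyIntegrable.locallyIntegrableOn _ |>.smul_continuousOn
        isOpen_univ.isLocallyClosed hf.continuous.continuousOn)
  · filter_upwards [hp.ae_hasDerivAt, hf.ae_hasDerivAt] with x h1 h2
    exact h1.smul h2

theorem ofReal {p q : ℝ → ℝ} (hp : IsPrimitive p q) :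
    IsPrimitive (fun x => (p x : ℂ)) (fun x => (q x : ℂ)) :=
  hp.clm_comp Complex.ofRealCLM

theorem conj {f g : ℝ → ℂ} (hf : IsPrimitive f g) :
    IsPrimitive (fun x => starRingEnd ℂ (f x)) (fun x => starRingEnd ℂ (g x)) :=
  hf.clm_comp Complex.conjCLE.toContinuousLinearMap

theorem mul {f g h k : ℝ → ℂ} (hf : IsPrimitive f g) (hh : IsPrimitive h k) :
    IsPrimitive (fun x => f x * h x) (fun x => f x * k x + g x * h x) :=
  hf.smul hh

theorem norm_sq {f g : ℝ → ℂ} (hf : IsPrimitive f g) :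
    IsPrimitive (fun x => ‖f x‖ ^ 2) (fun x => 2 * (g x * starRingEnd ℂ (f x)).re) := by
  convert! (hf.mul hf.conj).clm_comp Complex.reCLM using 2 with x
  · rw [Complex.mul_conj, Complex.normSq_eq_norm_sq]
    exact (Complex.ofReal_re _).symm
  · simp only [Complex.reCLM_apply, Complex.add_re, Complex.mul_re, Complex.conj_re,
      Complex.conj_im]
    ring

end IsPrimitive

end Primitive

section WeakDerivative

theorem exists_pos_forall_abs_ge_eq_zero {E : Type*} [Zero E] {f : ℝ → E}
    (hf : HasCompactSupport f) :
    ∃ a, 0 < a ∧ ∀ x, a ≤ |x| → f x = 0 := by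
  obtain ⟨a, ha⟩ := hf.isBounded.subset_ball 0
  refine ⟨max a 1, by positivity, fun x hx => image_eq_zero_of_notMem_tsupport fun hx' => ?_⟩
  have := ha hx'
  rw [mem_ball_zero_iff, Real.norm_eq_abs] at this
  linarith [le_max_left a 1]

theorem hasCompactSupport_of_forall_abs_ge {E : Type*} [Zero E] {f : ℝ → E} {a : ℝ}
    (hf : ∀ x, a ≤ |x| → f x = 0) :
    HasCompactSupport f :=
  HasCompactSupport.intro (isCompact_Icc (a := -a) (b := a)) fun x hx =>
    hf x (not_lt.mp fun h => hx (abs_le.mp h.le))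

variable {E : Type*} [NormedAddCommGroup E] [NormedSpace ℝ E] {f f' g g' h k : ℝ → E}

theorem HasWeakDeriv.congr (hfg : HasWeakDeriv f g) (hf : f =ᵐ[volume] f')
    (hg : g =ᵐ[volume] g') : HasWeakDeriv f' g' := by
  refine ⟨hfg.1.congr hf, hfg.2.congr hg, fun ψ hψ hψc => ?_⟩
  calc ∫ x, deriv ψ x • f' x = ∫ x, deriv ψ x • f x :=
        integral_congr_ae (hf.mono fun x hx => by simp only [hx])
    _ = -∫ x, ψ x • g x := hfg.integral_eq ψ hψ hψc
    _ = -∫ x, ψ x • g' x := by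
        rw [integral_congr_ae (hg.mono fun x hx => congrArg (ψ x • ·) hx)]

theorem HasWeakDeriv.sub (hf : HasWeakDeriv f g) (hh : HasWeakDeriv h k) :
    HasWeakDeriv (fun x => f x - h x) (fun x => g x - k x) := by
  refine ⟨hf.1.sub hh.1, hf.2.sub hh.2, fun ψ hψ hψc => ?_⟩
  have hψ' := hψ.continuous_deriv (by simp)
  simp only [smul_sub]
  rw [integral_sub (hf.1.integrable_smul_left_of_hasCompactSupport hψ' hψc.deriv)
      (hh.1.integrable_smul_left_of_hasCompactSupport hψ' hψc.deriv),
    integral_sub (hf.2.integrable_smul_left_of_hasCompactSupport hψ.continuous hψc)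
      (hh.2.integrable_smul_left_of_hasCompactSupport hψ.continuous hψc),
    hf.integral_eq ψ hψ hψc, hh.integral_eq ψ hψ hψc]
  abel

variable [CompleteSpace E]

theorem HasWeakDeriv.ae_unique (hg : HasWeakDeriv f g) (hg' : HasWeakDeriv f g') :
    g =ᵐ[volume] g' :=
  ae_eq_of_integral_contDiff_smul_eq hg.locallyIntegrable_deriv hg'.locallyIntegrable_deriv
    fun ψ hψ hψc => by rw [← neg_inj, ← hg.integral_eq ψ hψ hψc, hg'.integral_eq ψ hψ hψc]

theorem IsPrimitive.hasWeakDeriv (hf : IsPrimitive f g) : HasWeakDeriv f g := by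
  refine ⟨hf.continuous.locallyIntegrable, hf.locallyIntegrable, fun ψ hψ hψc => ?_⟩
  have hψ' := hψ.continuous_deriv (by simp)
  have hψg := hf.locallyIntegrable.integrable_smul_left_of_hasCompactSupport hψ.continuous hψc
  have hfl : LocallyIntegrable f := hf.continuous.locallyIntegrable
  have hψf := hfl.integrable_smul_left_of_hasCompactSupport hψ' hψc.deriv
  have key := ((IsPrimitive.of_contDiff (hψ.of_le (by simp))).smul hf).integral_eq_zero
    (Continuous.integrable_of_hasCompactSupport (μ := volume) (f := fun x => ψ x • f x)
      (hψ.continuous.smul hf.continuous) hψc.smul_right)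
    (hψg.add hψf)
  rwa [integral_add hψg hψf, add_comm, ← eq_neg_iff_add_eq_zero] at key

theorem exists_contDiff_primitive {p : ℝ → E} {a : ℝ} (hp : ContDiff ℝ ∞ p)
    (hp0 : ∀ x, a ≤ |x| → p x = 0) (hpi : ∫ x, p x = 0) :
    ∃ ψ : ℝ → E, ContDiff ℝ ∞ ψ ∧ (∀ x, a ≤ |x| → ψ x = 0) ∧ ∀ x, HasDerivAt ψ (p x) x := by
  have hderiv : ∀ x, HasDerivAt (fun x => ∫ t in (-a)..x, p t) (p x) x := fun x =>
    intervalIntegral.integral_hasDerivAt_right (hp.continuous.intervalIntegrable _ _)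
      hp.continuous.stronglyMeasurable.stronglyMeasurableAtFilter hp.continuous.continuousAt
  refine ⟨fun x => ∫ t in (-a)..x, p t, ?_, fun x hx => ?_, hderiv⟩
  · rw [contDiff_infty_iff_deriv, funext fun x => (hderiv x).deriv]
    exact ⟨fun x => (hderiv x).differentiableAt, hp⟩
  · rcases le_abs.mp hx with hx | hx
    · refine (intervalIntegral.integral_eq_integral_of_support_subset fun y hy => ?_).trans hpi
      have hya : |y| < a := not_le.mp fun hay => hy (hp0 y hay)
      exact ⟨(abs_lt.mp hya).1, (abs_lt.mp hya).2.le.trans hx⟩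
    · refine (intervalIntegral.integral_congr fun y hy => ?_).trans intervalIntegral.integral_zero
      rw [uIcc_of_ge (by linarith)] at hy
      exact hp0 y (le_abs.mpr (Or.inr (by linarith [hy.2])))

theorem exists_contDiff_integral_eq_one {a : ℝ} (ha : 0 < a) : ∃ η : ℝ → ℝ, ContDiff ℝ ∞ η ∧
    (∀ x, a ≤ |x| → η x = 0) ∧ ∫ x, η x = 1 := by
  let b : ContDiffBump (0 : ℝ) := ⟨a / 2, a, by positivity, by linarith⟩
  refine ⟨b.normed volume, b.contDiff_normed, fun x hx => ?_, b.integral_normed⟩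
  rw [ContDiffBump.normed_def, b.zero_of_le_dist (by simpa using hx), zero_div]

theorem HasWeakDeriv.ae_eq_const (hf : HasWeakDeriv f 0) : ∃ c, f =ᵐ[volume] fun _ => c := by
  obtain ⟨η, hη, hη0, hη1⟩ := exists_contDiff_integral_eq_one one_pos
  have hηc := hasCompactSupport_of_forall_abs_ge hη0
  refine ⟨∫ x, η x • f x, ae_eq_of_integral_contDiff_smul_eq hf.1
    continuous_const.locallyIntegrable fun ψ hψ hψc => ?_⟩
  obtain ⟨a, -, hψ0⟩ := exists_pos_forall_abs_ge_eq_zero hψc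
  -- `ψ - (∫ ψ) η` has zero integral, hence is the derivative of a test function.
  obtain ⟨Θ, hΘ, hΘ0, hΘd⟩ := exists_contDiff_primitive (a := max a 1)
    (p := fun x => ψ x - (∫ y, ψ y) * η x) (hψ.sub (contDiff_const.mul hη))
    (fun x hx => by rw [hψ0 x ((le_max_left a 1).trans hx), hη0 x ((le_max_right a 1).trans hx),
      mul_zero, sub_zero])
    (by rw [integral_sub (hψ.continuous.integrable_of_hasCompactSupport hψc)
      ((hη.continuous.integrable_of_hasCompactSupport hηc).const_mul _), integral_const_mul, hη1,
      mul_one, sub_self])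
  have key := hf.integral_eq Θ hΘ (hasCompactSupport_of_forall_abs_ge hΘ0)
  simp only [fun x => (hΘd x).deriv, Pi.zero_apply, smul_zero, integral_zero, neg_zero, sub_smul,
    mul_smul] at key
  rw [integral_sub (g := fun x => (∫ y, ψ y) • η x • f x)
    (hf.1.integrable_smul_left_of_hasCompactSupport hψ.continuous hψc)
    ((hf.1.integrable_smul_left_of_hasCompactSupport hη.continuous hηc).smul _),
    integral_smul, sub_eq_zero] at key
  rw [key, integral_smul_const]

theorem HasWeakDeriv.exists_isPrimitive (hf : HasWeakDeriv f g) :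
    ∃ F, IsPrimitive F g ∧ f =ᵐ[volume] F := by
  have hG := isPrimitive_intervalIntegral hf.locallyIntegrable_deriv 0
  have h0 := hf.sub hG.hasWeakDeriv
  simp only [sub_self] at h0
  obtain ⟨c, hc⟩ := HasWeakDeriv.ae_eq_const h0
  refine ⟨fun x => c + ∫ t in (0 : ℝ)..x, g t, ⟨hG.1, fun x y => ?_⟩, ?_⟩
  · rw [← hG.sub_eq x y, add_sub_add_left_eq_sub]
  · filter_upwards [hc] with x hx
    rw [← hx, sub_add_cancel]

end WeakDerivative

section SquareIntegrable

variable {α E F : Type*} {m : MeasurableSpace α} {μ : Measure α} [NormedAddCommGroup E]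
  [NormedAddCommGroup F]

theorem lpNorm_two_sq {f : α → E} (hf : MemLp f 2 μ) : lpNorm f 2 μ ^ 2 = ∫ x, ‖f x‖ ^ 2 ∂μ := by
  rw [lpNorm_eq_integral_norm_rpow_toReal two_ne_zero ENNReal.ofNat_ne_top hf.1]
  simp only [ENNReal.toReal_ofNat, Real.rpow_ofNat]
  rw [← one_div, ← Real.sqrt_eq_rpow, Real.sq_sqrt (integral_nonneg fun x => by positivity)]

theorem integral_norm_mul_norm_le_lpNorm_mul_lpNorm {f : α → E} {g : α → F} (hf : MemLp f 2 μ)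
    (hg : MemLp g 2 μ) : ∫ x, ‖f x‖ * ‖g x‖ ∂μ ≤ lpNorm f 2 μ * lpNorm g 2 μ := by
  have h := integral_mul_norm_le_Lp_mul_Lq (f := fun x => ‖f x‖) (g := fun x => ‖g x‖)
    Real.HolderConjugate.two_two (by simpa using hf.norm) (by simpa using hg.norm)
  simpa only [norm_norm, Real.rpow_ofNat, ← lpNorm_two_sq hf, ← lpNorm_two_sq hg,
    ← Real.sqrt_eq_rpow, Real.sqrt_sq lpNorm_nonneg] using h

theorem norm_integral_mul_le_lpNorm_mul_lpNorm {𝕜 : Type*} [RCLike 𝕜] {f g : α → 𝕜}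
    (hf : MemLp f 2 μ) (hg : MemLp g 2 μ) :
    ‖∫ x, f x * g x ∂μ‖ ≤ lpNorm f 2 μ * lpNorm g 2 μ := by
  refine (norm_integral_le_integral_norm _).trans ?_
  simpa only [norm_mul] using integral_norm_mul_norm_le_lpNorm_mul_lpNorm hf hg

end SquareIntegrable

section H1

variable {f f' g h k : ℝ → ℂ}

theorem HasWeakDeriv.hasWeakDeriv_weakDeriv (hf : HasWeakDeriv f g) :
    HasWeakDeriv f (weakDeriv f) := by
  rw [weakDeriv, dif_pos ⟨g, hf⟩]
  exact Exists.choose_spec (⟨g, hf⟩ : ∃ g, HasWeakDeriv f g)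

theorem HasWeakDeriv.weakDeriv_ae_eq (hf : HasWeakDeriv f g) : weakDeriv f =ᵐ[volume] g :=
  hf.hasWeakDeriv_weakDeriv.ae_unique hf

theorem weakDeriv_congr_ae (hf : f =ᵐ[volume] f') : weakDeriv f =ᵐ[volume] weakDeriv f' := by
  by_cases hex : ∃ g, HasWeakDeriv f g
  · obtain ⟨g, hg⟩ := hex
    exact hg.weakDeriv_ae_eq.trans (hg.congr hf (ae_eq_refl g)).weakDeriv_ae_eq.symm
  · have hex' : ¬∃ g, HasWeakDeriv f' g :=
      fun ⟨g, hg⟩ => hex ⟨g, hg.congr hf.symm (ae_eq_refl g)⟩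
    rw [weakDeriv, weakDeriv, dif_neg hex, dif_neg hex']

theorem h1Norm_congr_ae (hf : f =ᵐ[volume] f') : h1Norm f = h1Norm f' := by
  rw [h1Norm, h1Norm, integral_congr_ae (hf.mono fun x hx => congrArg (‖·‖ ^ 2) hx),
    integral_congr_ae ((weakDeriv_congr_ae hf).mono fun x hx => congrArg (‖·‖ ^ 2) hx)]

theorem h1Norm_nonneg (f : ℝ → ℂ) : 0 ≤ h1Norm f := Real.sqrt_nonneg _

/-- `f` is the continuous representative of a function in `H¹(ℝ)` with weak derivative `g`. -/
structure IsH1Pair (f g : ℝ → ℂ) : Prop where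
  isPrimitive : IsPrimitive f g
  memLp : MemLp f 2
  memLp_deriv : MemLp g 2

theorem MemH1.exists_isH1Pair (hf : MemH1 f) :
    ∃ F, IsH1Pair F (weakDeriv f) ∧ f =ᵐ[volume] F := by
  obtain ⟨hf2, g, hg, hg2⟩ := hf
  obtain ⟨F, hF, hfF⟩ := hg.hasWeakDeriv_weakDeriv.exists_isPrimitive
  exact ⟨F, ⟨hF, (memLp_congr_ae hfF).mp hf2, (memLp_congr_ae hg.weakDeriv_ae_eq).mpr hg2⟩, hfF⟩

namespace IsH1Pair

theorem memH1 (hf : IsH1Pair f g) : MemH1 f :=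
  ⟨hf.memLp, g, hf.isPrimitive.hasWeakDeriv, hf.memLp_deriv⟩

theorem continuous (hf : IsH1Pair f g) : Continuous f := hf.isPrimitive.continuous

theorem sub (hf : IsH1Pair f g) (hh : IsH1Pair h k) :
    IsH1Pair (fun x => f x - h x) (fun x => g x - k x) :=
  ⟨hf.isPrimitive.sub hh.isPrimitive, hf.memLp.sub hh.memLp, hf.memLp_deriv.sub hh.memLp_deriv⟩

theorem h1Norm_sq (hf : IsH1Pair f g) :
    h1Norm f ^ 2 = lpNorm f 2 volume ^ 2 + lpNorm g 2 volume ^ 2 := by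
  rw [h1Norm, Real.sq_sqrt (add_nonneg (integral_nonneg fun _ => sq_nonneg _)
    (integral_nonneg fun _ => sq_nonneg _)), lpNorm_two_sq hf.memLp, lpNorm_two_sq hf.memLp_deriv,
    integral_congr_ae (hf.isPrimitive.hasWeakDeriv.weakDeriv_ae_eq.mono
      fun x hx => congrArg (‖·‖ ^ 2) hx)]

theorem lpNorm_deriv_le (hf : IsH1Pair f g) : lpNorm g 2 volume ≤ h1Norm f :=
  abs_le_of_sq_le_sq' (by rw [hf.h1Norm_sq]; nlinarith) (h1Norm_nonneg f) |>.2

theorem norm_sq_le (hf : IsH1Pair f g) (x : ℝ) :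
    ‖f x‖ ^ 2 ≤ lpNorm f 2 volume * lpNorm g 2 volume := by
  have hgf : Integrable fun x => g x * starRingEnd ℂ (f x) :=
    hf.memLp_deriv.integrable_mul (MemLp.star hf.memLp)
  have hbound := hf.isPrimitive.norm_sq.two_mul_norm_le_integral_norm
    (hf.memLp.integrable_norm_pow two_ne_zero) (hgf.re.const_mul 2) x
  have hmono : ∫ y, ‖2 * (g y * starRingEnd ℂ (f y)).re‖ ≤ ∫ y, 2 * (‖f y‖ * ‖g y‖) := by
    refine integral_mono (hgf.re.const_mul 2).norm
      ((hf.memLp.norm.integrable_mul hf.memLp_deriv.norm).const_mul 2) fun y => ?_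
    simp only [norm_mul, Real.norm_ofNat, Real.norm_eq_abs]
    gcongr
    exact (Complex.abs_re_le_norm _).trans_eq (by rw [norm_mul, RCLike.norm_conj, mul_comm])
  rw [integral_const_mul] at hmono
  rw [norm_pow, norm_norm] at hbound
  linarith [integral_norm_mul_norm_le_lpNorm_mul_lpNorm hf.memLp hf.memLp_deriv]

theorem norm_le (hf : IsH1Pair f g) (x : ℝ) : ‖f x‖ ≤ h1Norm f := by
  refine abs_le_of_sq_le_sq' ?_ (h1Norm_nonneg f) |>.2
  rw [hf.h1Norm_sq]
  nlinarith [hf.norm_sq_le x, sq_nonneg (lpNorm f 2 volume - lpNorm g 2 volume)]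

end IsH1Pair

end H1

section FreeGroup

open FourierTransform LineDeriv

/-- The derivative of a Schwartz function on the line. -/
noncomputable def schwartzDeriv (ψ : 𝓢(ℝ, ℂ)) : 𝓢(ℝ, ℂ) := SchwartzMap.derivCLM ℂ ℂ ψ

/-- The product of a Schwartz function with the coordinate `x`, which is written `⟪x, 1⟫` to match
the formulas for Fourier transforms of derivatives. -/
noncomputable def schwartzMulX (ψ : 𝓢(ℝ, ℂ)) : 𝓢(ℝ, ℂ) :=
  SchwartzMap.smulLeftCLM ℂ (fun x : ℝ => inner ℝ x (1 : ℝ)) ψ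

theorem norm_freeSymbol (τ ξ : ℝ) : ‖freeSymbol τ ξ‖ = 1 := by
  rw [freeSymbol, Complex.norm_exp_ofReal_mul_I]

theorem hasDerivAt_freeSymbol_time (τ ξ : ℝ) : HasDerivAt (fun τ => freeSymbol τ ξ)
    (-(4 * Real.pi ^ 2 * ξ ^ 2) * Complex.I * freeSymbol τ ξ) τ := by
  have hphase : HasDerivAt (fun τ : ℝ => -(4 * Real.pi ^ 2 * τ) * ξ ^ 2)
      (-(4 * Real.pi ^ 2 * 1) * ξ ^ 2) τ :=
    ((hasDerivAt_id τ).const_mul _).neg.mul_const _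
  convert! (hphase.ofReal_comp.mul_const Complex.I).cexp using 1
  rw [freeSymbol]
  push_cast
  ring

theorem hasDerivAt_freeSymbol (τ ξ : ℝ) :
    HasDerivAt (freeSymbol τ) (-(8 * Real.pi ^ 2 * τ * ξ) * Complex.I * freeSymbol τ ξ) ξ := by
  have hphase := (hasDerivAt_pow 2 ξ).const_mul (-(4 * Real.pi ^ 2 * τ))
  convert! (hphase.ofReal_comp.mul_const Complex.I).cexp using 1
  rw [freeSymbol]
  push_cast
  ring

theorem freeGroup_eq_fourierInv (τ : ℝ) (ψ : 𝓢(ℝ, ℂ)) :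
    freeGroup τ ψ = 𝓕⁻ (SchwartzMap.smulLeftCLM ℂ (freeSymbol τ) (𝓕 ψ)) := rfl

theorem freeGroup_apply (τ : ℝ) (ψ : 𝓢(ℝ, ℂ)) (x : ℝ) :
    freeGroup τ ψ x = ∫ ξ : ℝ, 𝐞 (ξ * x) • (freeSymbol τ ξ * (𝓕 ψ) ξ) := by
  rw [freeGroup_eq_fourierInv, SchwartzMap.fourierInv_coe, Real.fourierInv_eq]
  simp only [SchwartzMap.smulLeftCLM_apply_apply (hasTemperateGrowth_freeSymbol τ), smul_eq_mul,
    RCLike.inner_apply, conj_trivial, mul_comm x]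

theorem freeGroup_zero (ψ : 𝓢(ℝ, ℂ)) : freeGroup 0 ψ = ψ := by
  have hone : freeSymbol 0 = fun _ => (1 : ℂ) := by ext ξ; simp [freeSymbol]
  rw [freeGroup, hone]
  simp

theorem freeGroup_freeGroup (s τ : ℝ) (ψ : 𝓢(ℝ, ℂ)) :
    freeGroup s (freeGroup τ ψ) = freeGroup (s + τ) ψ := by
  have hmul : freeSymbol s * freeSymbol τ = freeSymbol (s + τ) := by
    ext ξ
    simp only [Pi.mul_apply, freeSymbol, ← Complex.exp_add]
    congr 1
    push_cast
    ring
  rw [freeGroup, freeGroup, SchwartzMap.fourierMultiplierCLM_fourierMultiplierCLM_apply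
    (hasTemperateGrowth_freeSymbol s) (hasTemperateGrowth_freeSymbol τ), hmul, freeGroup]

theorem fourier_schwartzDeriv (ψ : 𝓢(ℝ, ℂ)) (ξ : ℝ) :
    (𝓕 (schwartzDeriv ψ)) ξ = 2 * Real.pi * Complex.I * ξ * (𝓕 ψ) ξ := by
  have hline : schwartzDeriv ψ = ∂_{(1 : ℝ)} ψ := by
    ext x
    rw [SchwartzMap.lineDerivOp_apply_eq_fderiv, fderiv_apply_one_eq_deriv]
    rfl
  rw [hline, SchwartzMap.fourier_lineDerivOp_eq, _root_.smul_apply,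
    SchwartzMap.smulLeftCLM_apply_apply (by fun_prop)]
  simp only [RCLike.inner_apply, conj_trivial, one_mul, Complex.real_smul, smul_eq_mul]
  ring

theorem hasDerivAt_fourier (ψ : 𝓢(ℝ, ℂ)) (ξ : ℝ) :
    HasDerivAt (𝓕 ψ : 𝓢(ℝ, ℂ)) (-(2 * Real.pi * Complex.I) * (𝓕 (schwartzMulX ψ)) ξ) ξ := by
  have h := congrArg (fun f : 𝓢(ℝ, ℂ) => f ξ) (SchwartzMap.lineDerivOp_fourier_eq ψ (1 : ℝ))
  rw [FourierTransform.fourier_smul] at h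
  simp only [_root_.smul_apply, smul_eq_mul, SchwartzMap.lineDerivOp_apply_eq_fderiv,
    fderiv_apply_one_eq_deriv] at h
  exact h ▸ (𝓕 ψ : 𝓢(ℝ, ℂ)).differentiableAt.hasDerivAt

theorem hasDerivAt_freeGroup (ψ : 𝓢(ℝ, ℂ)) (x τ : ℝ) :
    HasDerivAt (fun τ => freeGroup τ ψ x)
      (Complex.I * freeGroup τ (schwartzDeriv (schwartzDeriv ψ)) x) τ := by
  have hmeas (φ : 𝓢(ℝ, ℂ)) (τ : ℝ) : AEStronglyMeasurable
      (fun ξ : ℝ => 𝐞 (ξ * x) • (freeSymbol τ ξ * (𝓕 φ) ξ)) := by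
    have hc := (hasTemperateGrowth_freeSymbol τ).1.continuous
    exact Continuous.aestronglyMeasurable (by fun_prop)
  have hnorm (φ : 𝓢(ℝ, ℂ)) (τ ξ : ℝ) :
      ‖𝐞 (ξ * x) • (freeSymbol τ ξ * (𝓕 φ) ξ)‖ = ‖(𝓕 φ) ξ‖ := by
    rw [Circle.norm_smul, norm_mul, norm_freeSymbol, one_mul]
  have hfourier (ξ : ℝ) : (𝓕 (schwartzDeriv (schwartzDeriv ψ))) ξ =
      (-(4 * Real.pi ^ 2 * ξ ^ 2) : ℂ) * (𝓕 ψ) ξ := by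
    rw [fourier_schwartzDeriv, fourier_schwartzDeriv]
    linear_combination 4 * Real.pi ^ 2 * ξ ^ 2 * (𝓕 ψ) ξ * Complex.I_sq
  generalize schwartzDeriv (schwartzDeriv ψ) = χ at hfourier ⊢
  simp only [freeGroup_apply, ← integral_const_mul]
  refine (hasDerivAt_integral_of_dominated_loc_of_deriv_le (μ := volume) (𝕜 := ℝ)
    (F := fun τ ξ => 𝐞 (ξ * x) • (freeSymbol τ ξ * (𝓕 ψ) ξ))
    (F' := fun τ ξ => Complex.I * 𝐞 (ξ * x) • (freeSymbol τ ξ * (𝓕 χ) ξ))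
    (bound := fun ξ => ‖(𝓕 χ) ξ‖) (s := univ) univ_mem ?_ ?_ ?_ ?_ ?_ ?_).2
  · exact Eventually.of_forall fun τ => hmeas ψ τ
  · exact (𝓕 ψ).integrable.norm.mono' (hmeas ψ τ) (Eventually.of_forall fun ξ => (hnorm ψ τ ξ).le)
  · exact (hmeas χ τ).const_mul _
  · refine Eventually.of_forall fun ξ τ _ => ?_
    rw [norm_mul, hnorm, Complex.norm_I, one_mul]
  · exact (𝓕 χ).integrable.norm
  · refine Eventually.of_forall fun ξ τ _ => ?_
    convert! ((hasDerivAt_freeSymbol_time τ ξ).mul_const ((𝓕 ψ) ξ)).const_smul (𝐞 (ξ * x)) using 1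
    rw [hfourier, mul_smul_comm]
    congr 1
    ring

theorem lineDeriv_freeSymbol_smul_fourier (ψ : 𝓢(ℝ, ℂ)) (τ : ℝ) :
    ∂_{(1 : ℝ)} (SchwartzMap.smulLeftCLM ℂ (freeSymbol τ) (𝓕 ψ)) =
      -(4 * Real.pi * τ : ℂ) • SchwartzMap.smulLeftCLM ℂ (freeSymbol τ) (𝓕 (schwartzDeriv ψ)) +
        -(2 * Real.pi * Complex.I) •
          SchwartzMap.smulLeftCLM ℂ (freeSymbol τ) (𝓕 (schwartzMulX ψ)) := by
  ext ξ
  have hcoe : (SchwartzMap.smulLeftCLM ℂ (freeSymbol τ) (𝓕 ψ) : ℝ → ℂ) =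
      fun ξ => freeSymbol τ ξ * (𝓕 ψ) ξ :=
    funext fun ξ => SchwartzMap.smulLeftCLM_apply_apply (hasTemperateGrowth_freeSymbol τ) _ ξ
  rw [SchwartzMap.lineDerivOp_apply_eq_fderiv, fderiv_apply_one_eq_deriv, hcoe,
    ((hasDerivAt_freeSymbol τ ξ).fun_mul (hasDerivAt_fourier ψ ξ)).deriv]
  simp only [_root_.add_apply, _root_.smul_apply, smul_eq_mul,
    SchwartzMap.smulLeftCLM_apply_apply (hasTemperateGrowth_freeSymbol τ), fourier_schwartzDeriv]
  ring

theorem mul_freeGroup (ψ : 𝓢(ℝ, ℂ)) (τ x : ℝ) :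
    x * freeGroup τ ψ x =
      freeGroup τ (schwartzMulX ψ) x - 2 * Complex.I * τ * freeGroup τ (schwartzDeriv ψ) x := by
  have hinv := SchwartzMap.fourierInv_lineDerivOp_eq
    (SchwartzMap.smulLeftCLM ℂ (freeSymbol τ) (𝓕 ψ)) (1 : ℝ)
  rw [lineDeriv_freeSymbol_smul_fourier, FourierTransform.fourierInv_add,
    FourierTransform.fourierInv_smul, FourierTransform.fourierInv_smul,
    ← freeGroup_eq_fourierInv, ← freeGroup_eq_fourierInv, ← freeGroup_eq_fourierInv] at hinv
  have hx := congrArg (fun f : 𝓢(ℝ, ℂ) => f x) hinv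
  simp only [_root_.add_apply, _root_.smul_apply, smul_eq_mul] at hx
  rw [SchwartzMap.smulLeftCLM_apply_apply (by fun_prop)] at hx
  simp only [RCLike.inner_apply, conj_trivial, one_mul, Complex.real_smul] at hx
  refine mul_left_cancel₀ Complex.two_pi_I_ne_zero ?_
  linear_combination hx + 4 * Real.pi * τ * freeGroup τ (schwartzDeriv ψ) x * Complex.I_sq

theorem exists_abs_pow_mul_norm_freeGroup_le (k : ℕ) (ψ : 𝓢(ℝ, ℂ)) :
    ∃ C, ∀ τ x : ℝ, |τ| ≤ 1 → |x| ^ k * ‖freeGroup τ ψ x‖ ≤ C := by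
  induction k generalizing ψ with
  | zero =>
    refine ⟨∫ ξ, ‖(𝓕 ψ) ξ‖, fun τ x _ => ?_⟩
    rw [pow_zero, one_mul, freeGroup_apply]
    refine (norm_integral_le_integral_norm _).trans_eq ?_
    simp only [Circle.norm_smul, norm_mul, norm_freeSymbol, one_mul]
  | succ k ih =>
    obtain ⟨C₁, h₁⟩ := ih (schwartzMulX ψ)
    obtain ⟨C₂, h₂⟩ := ih (schwartzDeriv ψ)
    refine ⟨C₁ + 2 * C₂, fun τ x hτ => ?_⟩
    calc |x| ^ (k + 1) * ‖freeGroup τ ψ x‖ = |x| ^ k * ‖x * freeGroup τ ψ x‖ := by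
          rw [norm_mul, Complex.norm_real, Real.norm_eq_abs]; ring
      _ ≤ |x| ^ k * (‖freeGroup τ (schwartzMulX ψ) x‖ +
          2 * |τ| * ‖freeGroup τ (schwartzDeriv ψ) x‖) := by
          rw [mul_freeGroup]
          gcongr
          exact (norm_sub_le _ _).trans_eq (by simp)
      _ ≤ |x| ^ k * (‖freeGroup τ (schwartzMulX ψ) x‖ +
          2 * 1 * ‖freeGroup τ (schwartzDeriv ψ) x‖) := by gcongr
      _ ≤ C₁ + 2 * C₂ := by linarith [h₁ τ x hτ, h₂ τ x hτ]

/-- The decay weight `(1 + x²)⁻²`, which dominates freely evolved Schwartz functions uniformly for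
bounded times. -/
noncomputable def decay (x : ℝ) : ℝ := ((1 + x ^ 2) ^ 2)⁻¹

theorem decay_pos (x : ℝ) : 0 < decay x := by unfold decay; positivity

theorem continuous_decay : Continuous decay :=
  Continuous.inv₀ (by fun_prop) fun x => by positivity

theorem decay_le (x : ℝ) : decay x ≤ (1 + x ^ 2)⁻¹ := by
  unfold decay
  gcongr
  nlinarith [sq_nonneg x]

theorem integrable_decay : Integrable decay :=
  integrable_inv_one_add_sq.mono' continuous_decay.aestronglyMeasurable
    (Eventually.of_forall fun x => (Real.norm_of_nonneg (decay_pos x).le).trans_le (decay_le x))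

theorem one_le_mul_decay {a x : ℝ} (hx : |x| ≤ a) : 1 ≤ (1 + a ^ 2) ^ 2 * decay x := by
  have hsq : x ^ 2 ≤ a ^ 2 := sq_le_sq' (abs_le.mp hx).1 (abs_le.mp hx).2
  rw [decay, ← div_eq_mul_inv, one_le_div (by positivity)]
  exact pow_le_pow_left₀ (by positivity) (by linarith) 2

theorem exists_norm_freeGroup_le (ψ : 𝓢(ℝ, ℂ)) :
    ∃ C, ∀ τ x : ℝ, |τ| ≤ 1 → ‖freeGroup τ ψ x‖ ≤ C * decay x := by
  obtain ⟨C₀, h₀⟩ := exists_abs_pow_mul_norm_freeGroup_le 0 ψ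
  obtain ⟨C₂, h₂⟩ := exists_abs_pow_mul_norm_freeGroup_le 2 ψ
  obtain ⟨C₄, h₄⟩ := exists_abs_pow_mul_norm_freeGroup_le 4 ψ
  refine ⟨C₀ + 2 * C₂ + C₄, fun τ x hτ => ?_⟩
  rw [decay, ← div_eq_mul_inv, le_div_iff₀ (by positivity), ← sq_abs x]
  linarith [h₀ τ x hτ, h₂ τ x hτ, h₄ τ x hτ]

end FreeGroup

section WeakFlow

theorem norm_forcing_le {V : ℝ → ℝ} {f : ℝ → ℂ} {M x : ℝ} (hf : ‖f x‖ ≤ M) :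
    ‖forcing V f x‖ ≤ (M ^ 5 + M) * (1 + |V x|) := by
  have hM : 0 ≤ M := (norm_nonneg _).trans hf
  calc ‖forcing V f x‖ ≤ ‖f x‖ ^ 5 + |V x| * ‖f x‖ := by
        refine (norm_sub_le _ _).trans_eq ?_
        simp only [norm_mul, norm_pow, Complex.norm_real, Real.norm_eq_abs, abs_norm]
        ring
    _ ≤ M ^ 5 + |V x| * M := by gcongr
    _ ≤ (M ^ 5 + M) * (1 + |V x|) := by
        nlinarith [mul_nonneg (pow_nonneg hM 5) (abs_nonneg (V x))]

/-- If `Φ` tends to `L` at the diagonal point `(t₀, t₀)`, then `∫_{t₀}^t Φ(t, s) ds` has derivative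
`L` at `t₀`, whether or not `Φ` is differentiable in `t`. -/
theorem hasDerivAt_intervalIntegral_of_tendsto_diag {E : Type*} [NormedAddCommGroup E]
    [NormedSpace ℝ E] [CompleteSpace E] {Φ : ℝ → ℝ → E} {L : E} {t₀ : ℝ}
    (hΦ : Tendsto (Function.uncurry Φ) (𝓝 (t₀, t₀)) (𝓝 L))
    (hint : ∀ᶠ t in 𝓝 t₀, IntervalIntegrable (Φ t) volume t₀ t) :
    HasDerivAt (fun t => ∫ s in t₀..t, Φ t s) L t₀ := by
  rw [hasDerivAt_iff_isLittleO, Asymptotics.isLittleO_iff]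
  intro ε hε
  obtain ⟨δ, hδ, hclose⟩ := Metric.eventually_nhds_iff.mp
    (hΦ.eventually (Metric.closedBall_mem_nhds L hε))
  filter_upwards [hint, Metric.ball_mem_nhds t₀ hδ] with t hti ht
  rw [intervalIntegral.integral_same, sub_zero, ← intervalIntegral.integral_const,
    ← intervalIntegral.integral_sub hti intervalIntegrable_const, Real.norm_eq_abs]
  refine intervalIntegral.norm_integral_le_of_norm_le_const fun s hs => ?_
  rw [← dist_eq_norm]
  refine hclose (y := (t, s)) (max_lt ht ?_)
  rw [Real.dist_eq]
  exact (abs_sub_left_of_mem_uIcc (uIoc_subset_uIcc hs)).trans_lt ht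

theorem hasDerivAt_integral_mul_freeGroup {f : ℝ → ℂ} {M : ℝ} (hf : AEStronglyMeasurable f)
    (hfM : ∀ x, ‖f x‖ ≤ M) (ψ : 𝓢(ℝ, ℂ)) :
    HasDerivAt (fun τ => ∫ x, f x * freeGroup τ ψ x)
      (Complex.I * ∫ x, f x * schwartzDeriv (schwartzDeriv ψ) x) 0 := by
  obtain ⟨C, hC⟩ := exists_norm_freeGroup_le (schwartzDeriv (schwartzDeriv ψ))
  have hderiv := (hasDerivAt_integral_of_dominated_loc_of_deriv_le (μ := volume) (𝕜 := ℝ) (x₀ := 0)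
    (F := fun τ x => f x * freeGroup τ ψ x)
    (F' := fun τ x => f x * (Complex.I * freeGroup τ (schwartzDeriv (schwartzDeriv ψ)) x))
    (bound := fun x => M * (C * decay x)) (Metric.ball_mem_nhds 0 one_pos)
    (Eventually.of_forall fun τ => hf.mul (freeGroup τ ψ).continuous.aestronglyMeasurable)
    ((freeGroup 0 ψ).integrable.bdd_mul hf (Eventually.of_forall hfM))
    (hf.mul (continuous_const.mul
      (freeGroup 0 (schwartzDeriv (schwartzDeriv ψ))).continuous).aestronglyMeasurable)
    (Eventually.of_forall fun x τ hτ => ?_) ((integrable_decay.const_mul C).const_mul M)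
    (Eventually.of_forall fun x τ _ => (hasDerivAt_freeGroup ψ x τ).const_mul (f x))).2
  · simpa only [freeGroup_zero, mul_left_comm _ Complex.I, integral_const_mul] using hderiv
  · rw [mem_ball_zero_iff, Real.norm_eq_abs] at hτ
    rw [norm_mul, norm_mul, Complex.norm_I, one_mul]
    exact mul_le_mul (hfM x) (hC τ x hτ.le) (norm_nonneg _) ((norm_nonneg _).trans (hfM x))

/-- A trajectory of `H¹` functions satisfying Duhamel's formula on an open set of times, in terms of
its continuous representatives `U t` with weak derivatives `G t`. The potential is only required
to be integrable against `decay`, which suffices to pair the forcing term with test functions. -/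
structure IsWeakFlow (V : ℝ → ℝ) (J : Set ℝ) (U G : ℝ → ℝ → ℂ) : Prop where
  isOpen : IsOpen J
  isH1Pair : ∀ t ∈ J, IsH1Pair (U t) (G t)
  tendsto : ∀ t₀ ∈ J, Tendsto (fun t => h1Norm (fun x => U t x - U t₀ x)) (𝓝 t₀) (𝓝 0)
  integrable_mul_decay : Integrable (fun x => V x * decay x)
  intervalIntegrable_forcing : ∀ t ∈ J, ∀ ψ : 𝓢(ℝ, ℂ),
    IntervalIntegrable (fun s => ∫ x, forcing V (U s) x * freeGroup (t - s) ψ x) volume 0 t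
  duhamel : ∀ t ∈ J, ∀ ψ : 𝓢(ℝ, ℂ),
    ∫ x, U t x * ψ x =
      (∫ x, U 0 x * freeGroup t ψ x) +
        Complex.I * ∫ s in (0 : ℝ)..t, ∫ x, forcing V (U s) x * freeGroup (t - s) ψ x

namespace IsWeakFlow

variable {V : ℝ → ℝ} {J : Set ℝ} {U G : ℝ → ℝ → ℂ} {s t t₀ : ℝ}

theorem eventually_mem (h : IsWeakFlow V J U G) (ht₀ : t₀ ∈ J) : ∀ᶠ t in 𝓝 t₀, t ∈ J :=
  h.isOpen.mem_nhds ht₀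

theorem tendsto_apply (h : IsWeakFlow V J U G) (ht₀ : t₀ ∈ J) (x : ℝ) :
    Tendsto (fun t => U t x) (𝓝 t₀) (𝓝 (U t₀ x)) := by
  rw [tendsto_iff_norm_sub_tendsto_zero]
  refine squeeze_zero' (Eventually.of_forall fun _ => norm_nonneg _) ?_ (h.tendsto t₀ ht₀)
  filter_upwards [h.eventually_mem ht₀] with t ht
  exact ((h.isH1Pair t ht).sub (h.isH1Pair t₀ ht₀)).norm_le x

theorem exists_eventually_norm_le (h : IsWeakFlow V J U G) (ht₀ : t₀ ∈ J) :
    ∃ M, 0 ≤ M ∧ ∀ᶠ t in 𝓝 t₀, ∀ x, ‖U t x‖ ≤ M := by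
  refine ⟨h1Norm (U t₀) + 1, add_nonneg (h1Norm_nonneg _) zero_le_one, ?_⟩
  filter_upwards [h.eventually_mem ht₀, (h.tendsto t₀ ht₀).eventually (Iic_mem_nhds one_pos)]
    with t ht hclose x
  have hdiff := ((h.isH1Pair t ht).sub (h.isH1Pair t₀ ht₀)).norm_le x
  calc ‖U t x‖ ≤ ‖U t₀ x‖ + ‖U t x - U t₀ x‖ := norm_le_norm_add_norm_sub' _ _
    _ ≤ h1Norm (U t₀) + 1 := add_le_add ((h.isH1Pair t₀ ht₀).norm_le x) (hdiff.trans hclose)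

theorem integrable_one_add_abs_mul_decay (h : IsWeakFlow V J U G) :
    Integrable (fun x => (1 + |V x|) * decay x) := by
  refine (integrable_decay.add h.integrable_mul_decay.abs).congr (Eventually.of_forall fun x => ?_)
  simp only [Pi.add_apply, abs_mul, abs_of_pos (decay_pos x), add_mul, one_mul]

theorem aestronglyMeasurable_forcing (h : IsWeakFlow V J U G) (ht : t ∈ J) :
    AEStronglyMeasurable (forcing V (U t)) := by
  have hU := (h.isH1Pair t ht).continuous
  have hV : AEStronglyMeasurable V := by
    refine (h.integrable_mul_decay.1.mul
      (continuous_decay.inv₀ fun x => (decay_pos x).ne').aestronglyMeasurable).congr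
      (Eventually.of_forall fun x => ?_)
    simp only [Pi.mul_apply, Pi.inv_apply, mul_inv_cancel_right₀ (decay_pos x).ne']
  exact (Continuous.aestronglyMeasurable (by fun_prop)).sub
    ((Complex.continuous_ofReal.comp_aestronglyMeasurable hV).mul hU.aestronglyMeasurable)

theorem integrable_forcing_mul (h : IsWeakFlow V J U G) (ht : t ∈ J) {k : ℝ → ℂ} {C : ℝ}
    (hk : AEStronglyMeasurable k) (hkC : ∀ x, ‖k x‖ ≤ C * decay x) :
    Integrable (fun x => forcing V (U t) x * k x) := by
  set M := h1Norm (U t)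
  have hM : 0 ≤ M := h1Norm_nonneg _
  refine (h.integrable_one_add_abs_mul_decay.const_mul ((M ^ 5 + M) * C)).mono'
    ((h.aestronglyMeasurable_forcing ht).mul hk) (Eventually.of_forall fun x => ?_)
  calc ‖forcing V (U t) x * k x‖ ≤ (M ^ 5 + M) * (1 + |V x|) * (C * decay x) := by
        rw [norm_mul]
        exact mul_le_mul (norm_forcing_le ((h.isH1Pair t ht).norm_le x)) (hkC x) (norm_nonneg _)
          (by positivity)
    _ = _ := by ring

theorem tendsto_forcing (h : IsWeakFlow V J U G) (ht₀ : t₀ ∈ J) (x : ℝ) :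
    Tendsto (fun t => forcing V (U t) x) (𝓝 t₀) (𝓝 (forcing V (U t₀) x)) := by
  have hcont : Continuous fun z : ℂ => (‖z‖ : ℂ) ^ 4 * z - (V x : ℂ) * z := by fun_prop
  exact (hcont.tendsto _).comp (h.tendsto_apply ht₀ x)

theorem tendsto_integral_forcing_mul_freeGroup (h : IsWeakFlow V J U G) (ht₀ : t₀ ∈ J)
    (ψ : 𝓢(ℝ, ℂ)) {ι : Type*} {l : Filter ι} [l.IsCountablyGenerated] {r τ : ι → ℝ}
    (hr : Tendsto r l (𝓝 t₀)) (hτ : Tendsto τ l (𝓝 0)) :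
    Tendsto (fun i => ∫ x, forcing V (U (r i)) x * freeGroup (τ i) ψ x) l
      (𝓝 (∫ x, forcing V (U t₀) x * ψ x)) := by
  obtain ⟨M, hM, hUM⟩ := h.exists_eventually_norm_le ht₀
  obtain ⟨C, hC⟩ := exists_norm_freeGroup_le ψ
  refine tendsto_integral_filter_of_dominated_convergence
    (fun x => (M ^ 5 + M) * C * ((1 + |V x|) * decay x)) ?_ ?_
    (h.integrable_one_add_abs_mul_decay.const_mul _) (Eventually.of_forall fun x => ?_)
  · filter_upwards [hr.eventually (h.eventually_mem ht₀)] with i hi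
    exact (h.aestronglyMeasurable_forcing hi).mul
      (freeGroup (τ i) ψ).continuous.aestronglyMeasurable
  · filter_upwards [hr.eventually hUM, hτ.eventually (Metric.closedBall_mem_nhds 0 one_pos)]
      with i hUi hτi
    rw [Real.dist_eq, sub_zero] at hτi
    refine Eventually.of_forall fun x => ?_
    calc ‖forcing V (U (r i)) x * freeGroup (τ i) ψ x‖
        ≤ (M ^ 5 + M) * (1 + |V x|) * (C * decay x) := by
          rw [norm_mul]
          exact mul_le_mul (norm_forcing_le (hUi x)) (hC _ x hτi) (norm_nonneg _) (by positivity)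
      _ = _ := by ring
  · have hfree := (hasDerivAt_freeGroup ψ x 0).continuousAt.tendsto
    rw [freeGroup_zero] at hfree
    exact ((h.tendsto_forcing ht₀ x).comp hr).mul (hfree.comp hτ)

theorem intervalIntegrable_forcing_of_mem (h : IsWeakFlow V J U G) (hs : s ∈ J) (ht : t ∈ J)
    (ψ : 𝓢(ℝ, ℂ)) :
    IntervalIntegrable (fun r => ∫ x, forcing V (U r) x * freeGroup (t - r) ψ x) volume s t := by
  have hs0 := h.intervalIntegrable_forcing s hs (freeGroup (t - s) ψ)
  simp only [freeGroup_freeGroup, add_comm _ (t - s), sub_add_sub_cancel] at hs0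
  exact hs0.symm.trans (h.intervalIntegrable_forcing t ht ψ)

theorem duhamel_of_mem (h : IsWeakFlow V J U G) (hs : s ∈ J) (ht : t ∈ J) (ψ : 𝓢(ℝ, ℂ)) :
    ∫ x, U t x * ψ x = (∫ x, U s x * freeGroup (t - s) ψ x) +
      Complex.I * ∫ r in s..t, ∫ x, forcing V (U r) x * freeGroup (t - r) ψ x := by
  have hduhamel := h.duhamel s hs (freeGroup (t - s) ψ)
  simp only [freeGroup_freeGroup, add_comm _ (t - s), sub_add_sub_cancel, sub_add_cancel]
    at hduhamel
  rw [h.duhamel t ht ψ, hduhamel, add_assoc, ← mul_add,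
    ← intervalIntegral.integral_add_adjacent_intervals
      ((h.intervalIntegrable_forcing t ht ψ).trans
        (h.intervalIntegrable_forcing_of_mem hs ht ψ).symm)
      (h.intervalIntegrable_forcing_of_mem hs ht ψ)]

theorem hasDerivAt_integral_mul_schwartz (h : IsWeakFlow V J U G) (ht₀ : t₀ ∈ J) (ψ : 𝓢(ℝ, ℂ)) :
    HasDerivAt (fun t => ∫ x, U t x * ψ x)
      (Complex.I * (∫ x, U t₀ x * schwartzDeriv (schwartzDeriv ψ) x) +
        Complex.I * ∫ x, forcing V (U t₀) x * ψ x) t₀ := by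
  have hU := h.isH1Pair t₀ ht₀
  have hfree : HasDerivAt (fun t => ∫ x, U t₀ x * freeGroup (t - t₀) ψ x)
      (Complex.I * ∫ x, U t₀ x * schwartzDeriv (schwartzDeriv ψ) x) t₀ := by
    have hderiv := hasDerivAt_integral_mul_freeGroup hU.continuous.aestronglyMeasurable hU.norm_le ψ
    rw [← sub_self t₀] at hderiv
    exact hderiv.comp_sub_const t₀ t₀
  have hlag : Tendsto (fun p : ℝ × ℝ => p.1 - p.2) (𝓝 (t₀, t₀)) (𝓝 0) := by
    simpa using (show Continuous fun p : ℝ × ℝ => p.1 - p.2 by fun_prop).tendsto (t₀, t₀)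
  have hdiag : Tendsto (fun p : ℝ × ℝ => ∫ x, forcing V (U p.2) x * freeGroup (p.1 - p.2) ψ x)
      (𝓝 (t₀, t₀)) (𝓝 (∫ x, forcing V (U t₀) x * ψ x)) :=
    h.tendsto_integral_forcing_mul_freeGroup ht₀ ψ (continuous_snd.tendsto _) hlag
  have hforcing : HasDerivAt
      (fun t => ∫ s in t₀..t, ∫ x, forcing V (U s) x * freeGroup (t - s) ψ x)
      (∫ x, forcing V (U t₀) x * ψ x) t₀ :=
    hasDerivAt_intervalIntegral_of_tendsto_diag hdiag
      ((h.eventually_mem ht₀).mono fun t ht => h.intervalIntegrable_forcing_of_mem ht₀ ht ψ)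
  refine (hfree.fun_add (hforcing.const_mul Complex.I)).congr_of_eventuallyEq ?_
  filter_upwards [h.eventually_mem ht₀] with t ht
  exact h.duhamel_of_mem ht₀ ht ψ

theorem hasDerivAt_integral_mul_contDiff (h : IsWeakFlow V J U G) (ht₀ : t₀ ∈ J) {ψ : ℝ → ℂ}
    (hψ : ContDiff ℝ ∞ ψ) (hc : HasCompactSupport ψ) :
    HasDerivAt (fun t => ∫ x, U t x * ψ x)
      (Complex.I * (-(∫ x, G t₀ x * deriv ψ x) + ∫ x, forcing V (U t₀) x * ψ x)) t₀ := by
  have hU := h.isH1Pair t₀ ht₀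
  have hψ' : ContDiff ℝ ∞ (deriv ψ) := (contDiff_infty_iff_deriv.mp hψ).2
  have hparts : ∫ x, U t₀ x * deriv (deriv ψ) x = -∫ x, G t₀ x * deriv ψ x := by
    have hintG : Integrable (fun x => G t₀ x * deriv ψ x) :=
      hU.memLp_deriv.integrable_mul (q := 2)
        (hψ'.continuous.memLp_of_hasCompactSupport hc.deriv)
    have hintU : Integrable (fun x => U t₀ x * deriv (deriv ψ) x) :=
      (hU.continuous.mul (hψ'.continuous_deriv (by simp))).integrable_of_hasCompactSupport
        hc.deriv.deriv.mul_left
    have hintUψ : Integrable (fun x => U t₀ x * deriv ψ x) :=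
      (hU.continuous.mul hψ'.continuous).integrable_of_hasCompactSupport hc.deriv.mul_left
    have hzero := (hU.isPrimitive.mul (.of_contDiff (hψ'.of_le (by simp)))).integral_eq_zero
      hintUψ (hintU.add hintG)
    rw [integral_add hintU hintG] at hzero
    exact eq_neg_of_add_eq_zero_left hzero
  have hderiv (φ : 𝓢(ℝ, ℂ)) : ⇑(schwartzDeriv φ) = deriv φ :=
    funext fun x => SchwartzMap.derivCLM_apply ℂ φ x
  have hschwartz := h.hasDerivAt_integral_mul_schwartz ht₀ (hc.toSchwartzMap hψ)
  rw [hderiv, hderiv] at hschwartz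
  rw [mul_add, ← hparts]
  exact hschwartz

end IsWeakFlow

end WeakFlow

section FiniteMeasureSupport

variable {α E : Type*} [MeasurableSpace α] {μ : Measure α} [NormedAddCommGroup E] {f : α → E}
  {s : Set α}

theorem integrable_of_memLp_two_of_ae_notMem_eq_zero (hf : MemLp f 2 μ) (hs : μ s ≠ ⊤)
    (hf0 : ∀ᵐ x ∂μ, x ∉ s → f x = 0) : Integrable f μ :=
  have : IsFiniteMeasure (μ.restrict s) := ⟨by rwa [Measure.restrict_apply_univ, lt_top_iff_ne_top]⟩
  IntegrableOn.integrable_of_ae_notMem_eq_zero ((hf.restrict s).integrable one_le_two) hf0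

theorem integral_norm_le_sqrt_measureReal_mul_lpNorm (hf : MemLp f 2 μ) (hs : MeasurableSet s)
    (hs' : μ s ≠ ⊤) (hf0 : ∀ᵐ x ∂μ, x ∉ s → f x = 0) :
    ∫ x, ‖f x‖ ∂μ ≤ √(μ.real s) * lpNorm f 2 μ := by
  have hmem : MemLp (s.indicator fun _ => (1 : ℝ)) 2 μ :=
    memLp_indicator_const 2 hs 1 (Or.inr hs')
  have hnorm : lpNorm (s.indicator fun _ => (1 : ℝ)) 2 μ = √(μ.real s) := by
    rw [← Real.sqrt_sq lpNorm_nonneg, lpNorm_two_sq hmem, ← integral_indicator_one hs]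
    congr 2 with x
    by_cases hx : x ∈ s <;> simp [hx]
  calc ∫ x, ‖f x‖ ∂μ = ∫ x, ‖s.indicator (fun _ => (1 : ℝ)) x‖ * ‖f x‖ ∂μ := by
        refine integral_congr_ae (hf0.mono fun x hx => ?_)
        by_cases hxs : x ∈ s
        · simp [hxs]
        · simp [hxs, hx hxs]
    _ ≤ √(μ.real s) * lpNorm f 2 μ :=
        hnorm ▸ integral_norm_mul_norm_le_lpNorm_mul_lpNorm hmem hf

end FiniteMeasureSupport

theorem integral_mul_sub_of_memLp_two {α : Type*} [MeasurableSpace α] {μ : Measure α}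
    {f g h : α → ℂ} (hf : MemLp f 2 μ) (hg : MemLp g 2 μ) (hh : MemLp h 2 μ) :
    ∫ x, f x * (g x - h x) ∂μ = (∫ x, f x * g x ∂μ) - ∫ x, f x * h x ∂μ := by
  have hfg : Integrable (fun x => f x * g x) μ := hf.integrable_mul (q := 2) hg
  have hfh : Integrable (fun x => f x * h x) μ := hf.integrable_mul (q := 2) hh
  simp only [mul_sub, integral_sub hfg hfh]

section CompactlySupportedH1

variable {a : ℝ} {f f' χ χ' ψ : ℝ → ℂ} {w : ℝ → ℝ}

theorem memLp_two_ofReal_mul (hw : Continuous w) (hc : HasCompactSupport w) (hf : MemLp f 2) :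
    MemLp (fun x => (w x : ℂ) * f x) 2 :=
  MemLp.mul (p := ⊤) (q := 2) hf ((Complex.continuous_ofReal.comp hw).memLp_of_hasCompactSupport
    (hc.comp_left Complex.ofReal_zero))

namespace IsH1Pair

theorem of_contDiff (hψ : ContDiff ℝ 1 ψ) (hc : HasCompactSupport ψ) : IsH1Pair ψ (deriv ψ) :=
  ⟨.of_contDiff hψ, hψ.continuous.memLp_of_hasCompactSupport hc,
    (hψ.continuous_deriv le_rfl).memLp_of_hasCompactSupport hc.deriv⟩

theorem conj (hf : IsH1Pair f f') :
    IsH1Pair (fun x => starRingEnd ℂ (f x)) (fun x => starRingEnd ℂ (f' x)) :=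
  ⟨hf.isPrimitive.conj, MemLp.star hf.memLp, MemLp.star hf.memLp_deriv⟩

theorem ofReal_mul (hw : ContDiff ℝ 1 w) (hc : HasCompactSupport w) (hf : IsH1Pair f f') :
    IsH1Pair (fun x => w x * f x) (fun x => w x * f' x + deriv w x * f x) := by
  have hw' := hw.continuous_deriv le_rfl
  exact ⟨(IsPrimitive.of_contDiff hw).ofReal.mul hf.isPrimitive,
    memLp_two_ofReal_mul hw.continuous hc hf.memLp,
    (memLp_two_ofReal_mul hw.continuous hc hf.memLp_deriv).add
      (memLp_two_ofReal_mul hw' hc.deriv hf.memLp)⟩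

theorem ae_deriv_eq_zero (hχ : IsH1Pair χ χ') (hχ0 : ∀ x, a ≤ |x| → χ x = 0) :
    ∀ᵐ x, x ∉ Icc (-a) a → χ' x = 0 := by
  filter_upwards [hχ.isPrimitive.ae_hasDerivAt] with x hx hxa
  have hxa : a < |x| := not_le.mp fun h => hxa (abs_le.mp h)
  have hzero : χ =ᶠ[𝓝 x] fun _ => 0 := by
    filter_upwards [continuous_abs.continuousAt.eventually (Ioi_mem_nhds hxa)] with y hy
    exact hχ0 y (le_of_lt hy)
  exact hx.unique ((hasDerivAt_const x (0 : ℂ)).congr_of_eventuallyEq hzero)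

theorem integrable_deriv (hχ : IsH1Pair χ χ') (hχ0 : ∀ x, a ≤ |x| → χ x = 0) : Integrable χ' :=
  integrable_of_memLp_two_of_ae_notMem_eq_zero hχ.memLp_deriv isCompact_Icc.measure_ne_top
    (hχ.ae_deriv_eq_zero hχ0)

theorem integral_deriv_eq_zero (hχ : IsH1Pair χ χ') (hχ0 : ∀ x, a ≤ |x| → χ x = 0) :
    ∫ x, χ' x = 0 :=
  hχ.isPrimitive.integral_eq_zero
    (hχ.continuous.integrable_of_hasCompactSupport (hasCompactSupport_of_forall_abs_ge hχ0))
    (hχ.integrable_deriv hχ0)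

theorem norm_integral_le_lpNorm_deriv_sub (hχ : IsH1Pair χ χ') (hχ0 : ∀ x, a ≤ |x| → χ x = 0)
    {k : ℝ → ℂ} (hk : MemLp k 2) (hk0 : ∀ x, a ≤ |x| → k x = 0) :
    ‖∫ x, k x‖ ≤ √(volume.real (Icc (-a) a)) * lpNorm (fun x => χ' x - k x) 2 volume := by
  have hk0' (x : ℝ) (hx : x ∉ Icc (-a) a) : k x = 0 :=
    hk0 x (not_le.mp fun h => hx (abs_le.mp h)).le
  have hki : Integrable k := integrable_of_memLp_two_of_ae_notMem_eq_zero hk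
    isCompact_Icc.measure_ne_top (Eventually.of_forall hk0')
  have hint : ∫ x, (χ' x - k x) = -∫ x, k x := by
    rw [integral_sub (hχ.integrable_deriv hχ0) hki, hχ.integral_deriv_eq_zero hχ0, zero_sub]
  have hzero : ∀ᵐ x, x ∉ Icc (-a) a → χ' x - k x = 0 := by
    filter_upwards [hχ.ae_deriv_eq_zero hχ0] with x hx hxa
    rw [hx hxa, hk0' x hxa, sub_zero]
  rw [← norm_neg, ← hint]
  exact (norm_integral_le_integral_norm _).trans
    (integral_norm_le_sqrt_measureReal_mul_lpNorm (hχ.memLp_deriv.sub hk) measurableSet_Icc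
      isCompact_Icc.measure_ne_top hzero)

theorem exists_norm_le_mul_decay (a : ℝ) : ∃ C, 0 ≤ C ∧ ∀ χ χ' : ℝ → ℂ, IsH1Pair χ χ' →
    (∀ x, a ≤ |x| → χ x = 0) → ∀ x, ‖χ x‖ ≤ C * lpNorm χ' 2 volume * decay x := by
  refine ⟨(1 + a ^ 2) ^ 2 * √(volume.real (Icc (-a) a)), by positivity,
    fun χ χ' hχ hχ0 x => ?_⟩
  have hχN : 0 ≤ lpNorm χ' 2 volume := lpNorm_nonneg
  rcases le_total a |x| with hx | hx
  · rw [hχ0 x hx, norm_zero]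
    have := (decay_pos x).le
    positivity
  · have hsup : ‖χ x‖ ≤ √(volume.real (Icc (-a) a)) * lpNorm χ' 2 volume := by
      have htwo := hχ.isPrimitive.two_mul_norm_le_integral_norm
        (hχ.continuous.integrable_of_hasCompactSupport (hasCompactSupport_of_forall_abs_ge hχ0))
        (hχ.integrable_deriv hχ0) x
      have hCS := integral_norm_le_sqrt_measureReal_mul_lpNorm hχ.memLp_deriv measurableSet_Icc
        isCompact_Icc.measure_ne_top (hχ.ae_deriv_eq_zero hχ0)
      linarith [norm_nonneg (χ x)]
    calc ‖χ x‖ ≤ √(volume.real (Icc (-a) a)) * lpNorm χ' 2 volume * 1 := by rwa [mul_one]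
      _ ≤ √(volume.real (Icc (-a) a)) * lpNorm χ' 2 volume * ((1 + a ^ 2) ^ 2 * decay x) := by
          gcongr
          exact one_le_mul_decay hx
      _ = _ := by ring

end IsH1Pair

theorem exists_contDiff_lpNorm_sub_le (ha : 0 < a) (hf : MemLp f 2)
    (hf0 : ∀ᵐ x, x ∉ Icc (-a) a → f x = 0) {ε : ℝ} (hε : 0 < ε) :
    ∃ k : ℝ → ℂ, ContDiff ℝ ∞ k ∧ (∀ x, a + 1 ≤ |x| → k x = 0) ∧
      lpNorm (fun x => f x - k x) 2 volume ≤ ε := by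
  obtain ⟨p, -, hp, hpε⟩ := hf.exist_eLpNorm_sub_le (by simp) one_le_two hε
  let θ : ContDiffBump (0 : ℝ) := ⟨a, a + 1, ha, by linarith⟩
  have hk : ContDiff ℝ ∞ fun x => (θ x : ℂ) * p x :=
    (Complex.ofRealCLM.contDiff.comp θ.contDiff).mul hp
  refine ⟨fun x => θ x * p x, hk, fun x hx => ?_, ?_⟩
  · simp only [θ.zero_of_le_dist (show a + 1 ≤ dist x 0 by simpa using hx), Complex.ofReal_zero,
      zero_mul]
  · have hle : ∀ᵐ x, ‖f x - θ x * p x‖ ≤ ‖(f - p) x‖ := by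
      filter_upwards [hf0] with x hx
      have hfactor : f x - θ x * p x = θ x * (f x - p x) := by
        by_cases hxa : x ∈ Icc (-a) a
        · rw [θ.one_of_mem_closedBall (by simpa using abs_le.mpr hxa), Complex.ofReal_one,
            one_mul, one_mul]
        · rw [hx hxa, zero_sub, zero_sub, mul_neg]
      rw [hfactor, norm_mul, Complex.norm_real, Real.norm_of_nonneg θ.nonneg]
      exact mul_le_of_le_one_left (norm_nonneg _) θ.le_one
    have hfk : AEStronglyMeasurable fun x => f x - θ x * p x :=
      hf.1.sub hk.continuous.aestronglyMeasurable
    rw [← toReal_eLpNorm hfk]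
    exact ENNReal.toReal_le_of_le_ofReal hε.le ((eLpNorm_mono_ae hle).trans hpε)

theorem IsH1Pair.exists_contDiff_lpNorm_deriv_sub_le (ha : 0 < a) (hχ : IsH1Pair χ χ')
    (hχ0 : ∀ x, a ≤ |x| → χ x = 0) {ε : ℝ} (hε : 0 < ε) :
    ∃ ψ : ℝ → ℂ, ContDiff ℝ ∞ ψ ∧ (∀ x, a + 1 ≤ |x| → ψ x = 0) ∧
      lpNorm (fun x => χ' x - deriv ψ x) 2 volume ≤ ε := by
  obtain ⟨η, hη, hη0, hη1⟩ := exists_contDiff_integral_eq_one (by linarith : 0 < a + 1)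
  set B := lpNorm (fun x => (η x : ℂ)) 2 volume
  set S := √(volume.real (Icc (-(a + 1)) (a + 1)))
  have hB : 0 ≤ B := lpNorm_nonneg
  have hSB : 0 < 1 + S * B := by positivity
  obtain ⟨k, hk, hk0, hkε⟩ := exists_contDiff_lpNorm_sub_le ha hχ.memLp_deriv
    (hχ.ae_deriv_eq_zero hχ0) (ε := ε / (1 + S * B)) (by positivity)
  have hkm : MemLp k 2 :=
    hk.continuous.memLp_of_hasCompactSupport (hasCompactSupport_of_forall_abs_ge hk0)
  have hki : Integrable k :=
    hk.continuous.integrable_of_hasCompactSupport (hasCompactSupport_of_forall_abs_ge hk0)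
  have hηc : ContDiff ℝ ∞ fun x => (η x : ℂ) := Complex.ofRealCLM.contDiff.comp hη
  have hηs : HasCompactSupport fun x => (η x : ℂ) :=
    (hasCompactSupport_of_forall_abs_ge hη0).comp_left Complex.ofReal_zero
  have hzero (x : ℝ) (hx : a + 1 ≤ |x|) : χ x = 0 := hχ0 x (by linarith)
  have hm := (hχ.norm_integral_le_lpNorm_deriv_sub hzero hkm hk0).trans
    (mul_le_mul_of_nonneg_left hkε (Real.sqrt_nonneg _))
  -- Subtracting a multiple of `η` makes the approximation of `χ'` a derivative.
  obtain ⟨ψ, hψ, hψ0, hψd⟩ := exists_contDiff_primitive (a := a + 1)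
    (hk.sub (contDiff_const.mul hηc : ContDiff ℝ ∞ fun x => (∫ y, k y) * (η x : ℂ)))
    (fun x hx => by simp only [hk0 x hx, hη0 x hx, Complex.ofReal_zero, mul_zero, sub_zero])
    (by rw [integral_sub hki ((hηc.continuous.integrable_of_hasCompactSupport hηs).const_mul _),
          integral_const_mul, integral_complex_ofReal, hη1, Complex.ofReal_one, mul_one, sub_self])
  refine ⟨ψ, hψ, hψ0, ?_⟩
  have hsplit : (fun x => χ' x - deriv ψ x) =
      (fun x => χ' x - k x) + (∫ y, k y) • fun x => (η x : ℂ) := by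
    funext x
    simp only [(hψd x).deriv, Pi.add_apply, Pi.smul_apply, smul_eq_mul]
    ring
  calc lpNorm (fun x => χ' x - deriv ψ x) 2 volume
      ≤ lpNorm (fun x => χ' x - k x) 2 volume + ‖∫ y, k y‖ * B := by
        rw [hsplit, ← coe_nnnorm, ← lpNorm_const_smul]
        exact lpNorm_add_le (hχ.memLp_deriv.sub hkm) one_le_two
    _ ≤ ε / (1 + S * B) + S * (ε / (1 + S * B)) * B := by gcongr
    _ = ε := by field_simp

end CompactlySupportedH1

section LocalizedMass

/-- The value `i(∂ₓ²f + |f|⁴f - Vf)` of the right-hand side of the equation at `f`, paired with a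
test function `χ`; one derivative is moved onto the test function, and `g`, `χ'` stand for the
derivatives of `f` and `χ`. -/
noncomputable def weakRhs (V : ℝ → ℝ) (f g χ χ' : ℝ → ℂ) : ℂ :=
  Complex.I * (-(∫ x, g x * χ' x) + ∫ x, forcing V f x * χ x)

namespace IsWeakFlow

variable {V : ℝ → ℝ} {J : Set ℝ} {U G : ℝ → ℝ → ℂ} {a t t₀ : ℝ} {χ χ' ψ ψ' : ℝ → ℂ}

theorem integrable_forcing_mul_of_isH1Pair (h : IsWeakFlow V J U G) (ht : t ∈ J)
    (hχ : IsH1Pair χ χ') (hχ0 : ∀ x, a ≤ |x| → χ x = 0) :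
    Integrable (fun x => forcing V (U t) x * χ x) :=
  let ⟨_, _, hC⟩ := IsH1Pair.exists_norm_le_mul_decay a
  h.integrable_forcing_mul ht hχ.continuous.aestronglyMeasurable (hC χ χ' hχ hχ0)

theorem weakRhs_sub (h : IsWeakFlow V J U G) (ht : t ∈ J)
    (hχ : IsH1Pair χ χ') (hχ0 : ∀ x, a ≤ |x| → χ x = 0)
    (hψ : IsH1Pair ψ ψ') (hψ0 : ∀ x, a ≤ |x| → ψ x = 0) :
    weakRhs V (U t) (G t) (fun x => χ x - ψ x) (fun x => χ' x - ψ' x) =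
      weakRhs V (U t) (G t) χ χ' - weakRhs V (U t) (G t) ψ ψ' := by
  rw [weakRhs, integral_mul_sub_of_memLp_two (h.isH1Pair t ht).memLp_deriv hχ.memLp_deriv
    hψ.memLp_deriv]
  simp only [weakRhs, mul_sub, integral_sub (h.integrable_forcing_mul_of_isH1Pair ht hχ hχ0)
    (h.integrable_forcing_mul_of_isH1Pair ht hψ hψ0)]
  ring

theorem eventually_lpNorm_deriv_le (h : IsWeakFlow V J U G) (ht₀ : t₀ ∈ J) :
    ∀ᶠ t in 𝓝 t₀, lpNorm (G t) 2 volume ≤ lpNorm (G t₀) 2 volume + 1 := by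
  filter_upwards [h.eventually_mem ht₀, (h.tendsto t₀ ht₀).eventually (Iic_mem_nhds one_pos)]
    with t ht hclose
  have hdiff := (h.isH1Pair t ht).sub (h.isH1Pair t₀ ht₀)
  calc lpNorm (G t) 2 volume
      = lpNorm (G t₀ + fun x => G t x - G t₀ x) 2 volume := by
        congr 1; funext x; simp only [Pi.add_apply, add_sub_cancel]
    _ ≤ lpNorm (G t₀) 2 volume + lpNorm (fun x => G t x - G t₀ x) 2 volume :=
        lpNorm_add_le (h.isH1Pair t₀ ht₀).memLp_deriv one_le_two
    _ ≤ lpNorm (G t₀) 2 volume + 1 := by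
        gcongr
        exact hdiff.lpNorm_deriv_le.trans hclose

theorem exists_eventually_norm_weakRhs_le (h : IsWeakFlow V J U G) (ht₀ : t₀ ∈ J) (a : ℝ) :
    ∃ C, ∀ᶠ t in 𝓝 t₀, ∀ χ χ' : ℝ → ℂ, IsH1Pair χ χ' → (∀ x, a ≤ |x| → χ x = 0) →
      ‖weakRhs V (U t) (G t) χ χ'‖ ≤ C * lpNorm χ' 2 volume := by
  obtain ⟨M, hM, hUM⟩ := h.exists_eventually_norm_le ht₀
  obtain ⟨C, -, hC⟩ := IsH1Pair.exists_norm_le_mul_decay a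
  refine ⟨lpNorm (G t₀) 2 volume + 1 + (M ^ 5 + M) * C * ∫ x, (1 + |V x|) * decay x, ?_⟩
  filter_upwards [h.eventually_mem ht₀, hUM, h.eventually_lpNorm_deriv_le ht₀]
    with t ht hUt hGt χ χ' hχ hχ0
  have hχN : 0 ≤ lpNorm χ' 2 volume := lpNorm_nonneg
  have hkinetic : ‖∫ x, G t x * χ' x‖ ≤ (lpNorm (G t₀) 2 volume + 1) * lpNorm χ' 2 volume :=
    (norm_integral_mul_le_lpNorm_mul_lpNorm (h.isH1Pair t ht).memLp_deriv hχ.memLp_deriv).trans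
      (mul_le_mul_of_nonneg_right hGt hχN)
  have hforcing : ‖∫ x, forcing V (U t) x * χ x‖ ≤
      ∫ x, (M ^ 5 + M) * C * lpNorm χ' 2 volume * ((1 + |V x|) * decay x) := by
    refine norm_integral_le_of_norm_le (h.integrable_one_add_abs_mul_decay.const_mul _)
      (Eventually.of_forall fun x => ?_)
    calc ‖forcing V (U t) x * χ x‖
        ≤ (M ^ 5 + M) * (1 + |V x|) * (C * lpNorm χ' 2 volume * decay x) := by
          rw [norm_mul]
          exact mul_le_mul (norm_forcing_le (hUt x)) (hC χ χ' hχ hχ0 x) (norm_nonneg _)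
            (by positivity)
      _ = _ := by ring
  rw [integral_const_mul] at hforcing
  rw [weakRhs, norm_mul, Complex.norm_I, one_mul]
  refine (norm_add_le _ _).trans ?_
  rw [norm_neg]
  linarith

theorem tendsto_integral_mul (h : IsWeakFlow V J U G) (ht : t ∈ J) {ι : Type*} {l : Filter ι}
    {ψ ψ' : ι → ℝ → ℂ} (hχ : IsH1Pair χ χ') (hχ0 : ∀ x, a ≤ |x| → χ x = 0)
    (hψ : ∀ i, IsH1Pair (ψ i) (ψ' i)) (hψ0 : ∀ i x, a ≤ |x| → ψ i x = 0)
    (hlim : Tendsto (fun i => lpNorm (fun x => χ' x - ψ' i x) 2 volume) l (𝓝 0)) :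
    Tendsto (fun i => ∫ x, U t x * ψ i x) l (𝓝 (∫ x, U t x * χ x)) := by
  obtain ⟨C, -, hC⟩ := IsH1Pair.exists_norm_le_mul_decay a
  have hU := h.isH1Pair t ht
  rw [tendsto_iff_norm_sub_tendsto_zero]
  refine squeeze_zero (fun _ => norm_nonneg _) (fun i => ?_)
    (by simpa using hlim.mul_const (h1Norm (U t) * C * ∫ x, decay x))
  have hsub : (∫ x, U t x * ψ i x) - ∫ x, U t x * χ x = -∫ x, U t x * (χ x - ψ i x) := by
    rw [integral_mul_sub_of_memLp_two hU.memLp hχ.memLp (hψ i).memLp, neg_sub]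
  rw [hsub, norm_neg]
  set N := lpNorm (fun x => χ' x - ψ' i x) 2 volume
  have hbound : ‖∫ x, U t x * (χ x - ψ i x)‖ ≤ ∫ x, h1Norm (U t) * (C * N * decay x) := by
    refine norm_integral_le_of_norm_le ((integrable_decay.const_mul _).const_mul _)
      (Eventually.of_forall fun x => ?_)
    rw [norm_mul]
    exact mul_le_mul (hU.norm_le x)
      (hC _ _ (hχ.sub (hψ i)) (fun x hx => by rw [hχ0 x hx, hψ0 i x hx, sub_zero]) x)
      (norm_nonneg _) (h1Norm_nonneg _)
  rw [integral_const_mul, integral_const_mul] at hbound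
  linarith

theorem hasDerivAt_integral_mul (h : IsWeakFlow V J U G) (ht₀ : t₀ ∈ J) (ha : 0 < a)
    (hχ : IsH1Pair χ χ') (hχ0 : ∀ x, a ≤ |x| → χ x = 0) :
    HasDerivAt (fun t => ∫ x, U t x * χ x) (weakRhs V (U t₀) (G t₀) χ χ') t₀ := by
  choose ψ hψ hψ0 hψχ using fun n : ℕ =>
    hχ.exists_contDiff_lpNorm_deriv_sub_le ha hχ0 (Nat.one_div_pos_of_nat (α := ℝ) (n := n))
  have hψs (n : ℕ) : HasCompactSupport (ψ n) := hasCompactSupport_of_forall_abs_ge (hψ0 n)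
  have hψp (n : ℕ) : IsH1Pair (ψ n) (deriv (ψ n)) := .of_contDiff ((hψ n).of_le (by simp)) (hψs n)
  have hχ0' (x : ℝ) (hx : a + 1 ≤ |x|) : χ x = 0 := hχ0 x (by linarith)
  have hlim : Tendsto (fun n => lpNorm (fun x => χ' x - deriv (ψ n) x) 2 volume) atTop (𝓝 0) :=
    squeeze_zero (fun _ => lpNorm_nonneg) hψχ tendsto_one_div_add_atTop_nhds_zero_nat
  obtain ⟨C, hC⟩ := h.exists_eventually_norm_weakRhs_le ht₀ (a + 1)
  refine hasDerivAt_of_tendstoUniformlyOnFilter (l := atTop)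
    (f := fun n t => ∫ x, U t x * ψ n x)
    (f' := fun n t => weakRhs V (U t) (G t) (ψ n) (deriv (ψ n)))
    (g' := fun t => weakRhs V (U t) (G t) χ χ') ?_ ?_ ?_
  · rw [Metric.tendstoUniformlyOnFilter_iff]
    intro ε hε
    have hsmall : ∀ᶠ n in atTop, C * lpNorm (fun x => χ' x - deriv (ψ n) x) 2 volume < ε :=
      (hlim.const_mul C).eventually (gt_mem_nhds (by rwa [mul_zero]))
    filter_upwards [hsmall.prod_mk (hC.and (h.eventually_mem ht₀))] with ⟨n, t⟩ ⟨hn, hCt, ht⟩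
    rw [dist_eq_norm, ← h.weakRhs_sub ht hχ hχ0' (hψp n) (hψ0 n)]
    exact (hCt _ _ (hχ.sub (hψp n))
      fun x hx => by rw [hχ0' x hx, hψ0 n x hx, sub_zero]).trans_lt hn
  · exact ((h.eventually_mem ht₀).prod_inr _).mono fun p hp =>
      h.hasDerivAt_integral_mul_contDiff hp (hψ p.1) (hψs p.1)
  · filter_upwards [h.eventually_mem ht₀] with t ht
    exact h.tendsto_integral_mul ht hχ hχ0' hψp hψ0 hlim

end IsWeakFlow

variable {V : ℝ → ℝ} {J : Set ℝ} {U G : ℝ → ℝ → ℂ} {t₀ : ℝ} {f g : ℝ → ℂ} {w : ℝ → ℝ}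

theorem IsH1Pair.re_weakRhs_mul_conj (V : ℝ → ℝ) (hw : ContDiff ℝ 1 w) (hc : HasCompactSupport w)
    (hf : IsH1Pair f g) :
    (weakRhs V f g (fun x => w x * starRingEnd ℂ (f x))
      (fun x => w x * starRingEnd ℂ (g x) + deriv w x * starRingEnd ℂ (f x))).re =
      (∫ x, g x * (deriv w x * starRingEnd ℂ (f x))).im := by
  have hreal (z : ℂ) : z * starRingEnd ℂ z = ((‖z‖ ^ 2 : ℝ) : ℂ) := by
    rw [Complex.mul_conj, Complex.normSq_eq_norm_sq]
  have hforcing : ∫ x, forcing V f x * (w x * starRingEnd ℂ (f x)) =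
      ((∫ x, (‖f x‖ ^ 4 - V x) * w x * ‖f x‖ ^ 2 : ℝ) : ℂ) := by
    rw [← integral_complex_ofReal]
    congr 1 with x
    push_cast
    linear_combination (norm := (rw [forcing]; push_cast; ring))
      (((‖f x‖ : ℂ) ^ 4 - V x) * w x) * hreal (f x)
  have hkinetic : ∫ x, g x * (w x * starRingEnd ℂ (g x) + deriv w x * starRingEnd ℂ (f x)) =
      ((∫ x, w x * ‖g x‖ ^ 2 : ℝ) : ℂ) + ∫ x, g x * (deriv w x * starRingEnd ℂ (f x)) := by
    have hgg : Integrable (fun x => g x * (w x * starRingEnd ℂ (g x))) :=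
      hf.memLp_deriv.integrable_mul (q := 2)
        (memLp_two_ofReal_mul hw.continuous hc hf.conj.memLp_deriv)
    have hgf : Integrable (fun x => g x * (deriv w x * starRingEnd ℂ (f x))) :=
      hf.memLp_deriv.integrable_mul (q := 2)
        (memLp_two_ofReal_mul (hw.continuous_deriv le_rfl) hc.deriv hf.conj.memLp)
    simp only [mul_add]
    rw [integral_add hgg hgf, ← integral_complex_ofReal]
    simp only [mul_left_comm (g _), hreal, Complex.ofReal_mul]
  rw [weakRhs, hforcing, hkinetic]
  simp only [Complex.mul_re, Complex.I_re, Complex.I_im, Complex.add_im, Complex.neg_im,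
    Complex.ofReal_im]
  ring

theorem integral_mul_norm_sub_sq (hw : Continuous w) (hc : HasCompactSupport w)
    (hf : Continuous f) (hg : Continuous g) :
    ∫ x, w x * ‖f x - g x‖ ^ 2 = (∫ x, w x * ‖f x‖ ^ 2) -
      2 * (∫ x, f x * (w x * starRingEnd ℂ (g x))).re + ∫ x, w x * ‖g x‖ ^ 2 := by
  have hint {p : ℝ → ℂ} (hp : Continuous p) : Integrable (fun x => w x * ‖p x‖ ^ 2) :=
    (hw.mul (hp.norm.pow 2)).integrable_of_hasCompactSupport hc.mul_right
  have hcross : Integrable (fun x => f x * (w x * starRingEnd ℂ (g x))) :=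
    Continuous.integrable_of_hasCompactSupport (by fun_prop)
      ((hc.comp_left Complex.ofReal_zero).mul_right.mul_left)
  have hre : ∫ x, (f x * (w x * starRingEnd ℂ (g x))).re =
      (∫ x, f x * (w x * starRingEnd ℂ (g x))).re := integral_re hcross
  have hcross_re : Integrable (fun x => 2 * (f x * (w x * starRingEnd ℂ (g x))).re) :=
    hcross.re.const_mul 2
  have hdiff : Integrable
      (fun x => w x * ‖f x‖ ^ 2 - 2 * (f x * (w x * starRingEnd ℂ (g x))).re) :=
    (hint hf).sub hcross_re
  rw [← hre, ← integral_const_mul, ← integral_sub (hint hf) hcross_re,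
    ← integral_add hdiff (hint hg)]
  congr 1 with x
  rw [← Complex.normSq_eq_norm_sq, Complex.normSq_sub, Complex.normSq_eq_norm_sq,
    Complex.normSq_eq_norm_sq, mul_left_comm, Complex.re_ofReal_mul]
  ring

/-- Since `∫ w |U t - U t₀|²` is minimal at `t₀`, the derivative of the localized mass is twice that
of its polarization `t ↦ Re ∫ U t · w · conj (U t₀)`; the latter is linear in `U t`. -/
theorem IsWeakFlow.deriv_integral_mul_norm_sq (h : IsWeakFlow V J U G) (ht₀ : t₀ ∈ J)
    (hw : ContDiff ℝ 1 w) (hc : HasCompactSupport w) (hw0 : ∀ x, 0 ≤ w x)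
    (hd : DifferentiableAt ℝ (fun t => ∫ x, w x * ‖U t x‖ ^ 2) t₀) :
    deriv (fun t => ∫ x, w x * ‖U t x‖ ^ 2) t₀ =
      2 * (∫ x, G t₀ x * (deriv w x * starRingEnd ℂ (U t₀ x))).im := by
  have hU := h.isH1Pair t₀ ht₀
  obtain ⟨a, ha, hwa⟩ := exists_pos_forall_abs_ge_eq_zero hc
  have hpolar := (h.hasDerivAt_integral_mul ht₀ ha (hU.conj.ofReal_mul hw hc)
    fun x hx => by simp only [hwa x hx, Complex.ofReal_zero, zero_mul])
  have hpolar' := (Complex.reCLM.hasFDerivAt.comp_hasDerivAt t₀ hpolar)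
  have hdist : HasDerivAt (fun t => ∫ x, w x * ‖U t x - U t₀ x‖ ^ 2)
      (deriv (fun t => ∫ x, w x * ‖U t x‖ ^ 2) t₀ -
        2 * (∫ x, G t₀ x * (deriv w x * starRingEnd ℂ (U t₀ x))).im) t₀ := by
    rw [← hU.re_weakRhs_mul_conj V hw hc]
    refine ((hd.hasDerivAt.sub (hpolar'.const_mul 2)).add_const
      (∫ x, w x * ‖U t₀ x‖ ^ 2)).congr_of_eventuallyEq ?_
    filter_upwards [h.eventually_mem ht₀] with t ht
    exact integral_mul_norm_sub_sq hw.continuous hc (h.isH1Pair t ht).continuous hU.continuous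
  have hmin : IsLocalMin (fun t => ∫ x, w x * ‖U t x - U t₀ x‖ ^ 2) t₀ :=
    Eventually.of_forall fun t => by
      simpa using integral_nonneg fun x => mul_nonneg (hw0 x) (sq_nonneg ‖U t x - U t₀ x‖)
  exact sub_eq_zero.mp (hmin.hasDerivAt_eq_zero hdist)

end LocalizedMass

section CutoffProfile

theorem inv_sqrt_three_lt_one : 1 / √3 < 1 :=
  (div_lt_one (by positivity)).mpr (Real.lt_sqrt_of_sq_lt (by norm_num))

theorem inv_sqrt_three_sq : (1 / √3) ^ 2 = 1 / 3 := by
  rw [div_pow, Real.sq_sqrt (by norm_num), one_pow]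

namespace IsCutoffProfile

variable {ζ ζ₁ F : ℝ → ℝ} {s x : ℝ}

theorem eq_of_ae_eq_of_nonneg (hζ : IsCutoffProfile ζ) (hF : Continuous F) (h : ζ =ᵐ[volume] F)
    (hx : 0 ≤ x) : ζ x = F x := by
  have hpos : 0 < 1 / √3 := by positivity
  rcases le_total x 1 with h1 | h1
  · have hζc : ContinuousOn ζ (Icc 0 1) := ContinuousOn.congr (f := fun s => 2 * s) (by fun_prop)
      fun y hy => hζ.eq_linear y ((abs_of_nonneg hy.1).trans_le hy.2)
    exact Measure.eqOn_Icc_of_ae_eq volume zero_ne_one (ae_restrict_of_ae h) hζc hF.continuousOn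
      ⟨hx, h1⟩
  rcases le_or_gt x (1 + 1 / √3) with h2 | h2
  · have hζc : ContinuousOn ζ (Icc 1 (1 + 1 / √3)) :=
      ContinuousOn.congr (f := fun s => 2 * (s - (s - 1) ^ 3)) (by fun_prop)
        fun y hy => hζ.eq_pos y hy.1 hy.2
    exact Measure.eqOn_Icc_of_ae_eq volume (by linarith) (ae_restrict_of_ae h) hζc
      hF.continuousOn ⟨h1, h2⟩
  rcases lt_or_ge x 2 with h3 | h3
  · have hζc : ContinuousOn ζ (Ioo (1 + 1 / √3) 2) := fun y hy => by
      have hy0 : |y| = y := abs_of_pos (by linarith [hy.1])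
      exact (differentiableAt_of_deriv_ne_zero (hζ.deriv_neg y (hy0.symm ▸ hy.1)
        (hy0.symm ▸ hy.2)).ne).continuousAt.continuousWithinAt
    exact Measure.eqOn_open_of_ae_eq (ae_restrict_of_ae h) isOpen_Ioo hζc hF.continuousOn
      ⟨h2, h3⟩
  · have hζc : ContinuousOn ζ (Icc 2 (x + 1)) := ContinuousOn.congr (f := fun _ => 0) (by fun_prop)
      fun y hy => hζ.eq_zero y (hy.1.trans (le_abs_self y))
    exact Measure.eqOn_Icc_of_ae_eq volume (by linarith) (ae_restrict_of_ae h) hζc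
      hF.continuousOn ⟨h3, by linarith⟩

theorem eq_of_ae_eq (hζ : IsCutoffProfile ζ) (hF : Continuous F) (h : ζ =ᵐ[volume] F) :
    ζ = F := by
  funext x
  rcases le_total 0 x with hx | hx
  · exact hζ.eq_of_ae_eq_of_nonneg hF h hx
  · have hneg : ζ =ᵐ[volume] fun y => -F (-y) := by
      have hmp := Measure.measurePreserving_neg (volume : Measure ℝ)
      filter_upwards [hmp.quasiMeasurePreserving.ae h] with y hy
      rw [← hy, hζ.odd, neg_neg]
    have hζneg := hζ.eq_of_ae_eq_of_nonneg (F := fun y => -F (-y)) (by fun_prop) hneg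
      (neg_nonneg.mpr hx)
    rwa [hζ.odd, neg_neg, neg_inj] at hζneg

theorem isPrimitive (hζ : IsCutoffProfile ζ) (h : HasWeakDeriv ζ ζ₁) : IsPrimitive ζ ζ₁ := by
  obtain ⟨F, hF, hae⟩ := h.exists_isPrimitive
  rwa [hζ.eq_of_ae_eq hF.continuous hae]

theorem continuous (hζ : IsCutoffProfile ζ) : Continuous ζ :=
  let ⟨_, _, _, h⟩ := hζ.memW3Inf
  (hζ.isPrimitive h.deriv₁).continuous

theorem nonneg (hζ : IsCutoffProfile ζ) (hs : 0 ≤ s) : 0 ≤ ζ s := by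
  have hpos : 0 < 1 / √3 := by positivity
  rcases le_or_gt s 1 with h1 | h1
  · rw [hζ.eq_linear s (by rwa [abs_of_nonneg hs])]
    linarith
  rcases le_or_gt s (1 + 1 / √3) with h2 | h2
  · rw [hζ.eq_pos s h1.le h2]
    have hcube : (s - 1) ^ 3 ≤ 1 :=
      pow_le_one₀ (by linarith) (by linarith [inv_sqrt_three_lt_one])
    linarith
  rcases le_or_gt 2 s with h3 | h3
  · rw [hζ.eq_zero s (by rwa [abs_of_nonneg hs])]
  · have hanti : StrictAntiOn ζ (Icc (1 + 1 / √3) 2) := by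
      refine strictAntiOn_of_deriv_neg (convex_Icc _ _) hζ.continuous.continuousOn fun x hx => ?_
      rw [interior_Icc] at hx
      have hx0 : |x| = x := abs_of_pos (by linarith [hx.1])
      exact hζ.deriv_neg x (hx0.symm ▸ hx.1) (hx0.symm ▸ hx.2)
    have hle := hanti.antitoneOn ⟨h2.le, h3.le⟩ (right_mem_Icc.mpr (h2.trans h3).le) h3.le
    rwa [hζ.eq_zero 2 (by norm_num)] at hle

theorem deriv_neg_arg (hζ : IsCutoffProfile ζ) (s : ℝ) : deriv ζ (-s) = deriv ζ s := by
  have hodd : (fun y => ζ (-y)) = fun y => -ζ y := funext hζ.odd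
  have hderiv := deriv_comp_neg (f := ζ) s
  rwa [hodd, deriv.fun_neg, neg_inj, eq_comm] at hderiv

theorem deriv_eq_two (hζ : IsCutoffProfile ζ) (hs : |s| < 1) : deriv ζ s = 2 := by
  have heq : ζ =ᶠ[𝓝 s] fun y => 2 * y := by
    filter_upwards [continuous_abs.continuousAt.eventually (Iio_mem_nhds hs)] with y hy
    exact hζ.eq_linear y (le_of_lt hy)
  rw [heq.deriv_eq, deriv_const_mul_field, deriv_id'', mul_one]

theorem deriv_eq_of_cubic (hζ : IsCutoffProfile ζ) (h1 : 1 < s) (h2 : s < 1 + 1 / √3) :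
    deriv ζ s = 2 * (1 - 3 * (s - 1) ^ 2) := by
  have heq : ζ =ᶠ[𝓝 s] fun y => 2 * (y - (y - 1) ^ 3) := by
    filter_upwards [Ioo_mem_nhds h1 h2] with y hy
    exact hζ.eq_pos y hy.1.le hy.2.le
  have hcubic := ((hasDerivAt_id' s).sub (((hasDerivAt_id' s).sub_const 1).pow 3)).const_mul 2
  rw [heq.deriv_eq]
  simpa using hcubic.deriv

theorem deriv_nonpos (hζ : IsCutoffProfile ζ) (h1 : 1 + 1 / √3 < s) (h2 : s ≠ 2) :
    deriv ζ s ≤ 0 := by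
  have hs : |s| = s := abs_of_pos (lt_trans (by positivity) h1)
  rcases h2.lt_or_gt with h2 | h2
  · exact (hζ.deriv_neg s (hs.symm ▸ h1) (hs.symm ▸ h2)).le
  · have heq : ζ =ᶠ[𝓝 s] fun _ => 0 := by
      filter_upwards [Ioi_mem_nhds h2] with y hy
      exact hζ.eq_zero y ((le_of_lt hy).trans (le_abs_self y))
    rw [heq.deriv_eq, deriv_const]

end IsCutoffProfile

/-- A Lipschitz function comparable with `√(2 - ζ')`, which is the part of the kinetic term that the
localized virial identity loses outside `[-1, 1]`. -/
noncomputable def ramp (s : ℝ) : ℝ := min (max (|s| - 1) 0) 1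

theorem ramp_nonneg (s : ℝ) : 0 ≤ ramp s := le_min (le_max_right _ _) zero_le_one

theorem ramp_le_one (s : ℝ) : ramp s ≤ 1 := min_le_right _ _

theorem ramp_eq_zero {s : ℝ} (h : |s| ≤ 1) : ramp s = 0 := by
  rw [ramp, max_eq_right (by linarith), min_eq_left zero_le_one]

theorem lipschitzWith_ramp : LipschitzWith 1 ramp := by
  have habs : LipschitzWith 1 (fun s : ℝ => |s| - 1) := by
    refine LipschitzWith.of_dist_le_mul fun x y => ?_
    rw [Real.dist_eq, Real.dist_eq, NNReal.coe_one, one_mul, sub_sub_sub_cancel_right]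
    exact abs_abs_sub_abs_le x y
  exact (habs.max_const 0).min_const 1

namespace IsCutoffProfile

variable {ζ ζ₁ : ℝ → ℝ}

theorem ramp_sq_le_two_sub_deriv {s K : ℝ} (hζ : IsCutoffProfile ζ) (hK : -K ≤ deriv ζ s)
    (hK0 : 0 ≤ K) (hs : 0 ≤ s) (h1 : s ≠ 1) (h2 : s ≠ 1 + 1 / √3) (h3 : s ≠ 2) :
    ramp s ^ 2 ≤ 2 - deriv ζ s ∧ 2 - deriv ζ s ≤ (6 + 3 * K) * ramp s ^ 2 := by
  rcases h1.lt_or_gt with h1 | h1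
  · have hs1 : |s| < 1 := by rwa [abs_of_nonneg hs]
    rw [hζ.deriv_eq_two hs1, ramp_eq_zero hs1.le]
    norm_num
  rcases h2.lt_or_gt with h2 | h2
  · have hramp : ramp s = s - 1 := by
      rw [ramp, abs_of_nonneg hs, max_eq_left (by linarith),
        min_eq_left (by linarith [inv_sqrt_three_lt_one])]
    rw [hζ.deriv_eq_of_cubic h1 h2, hramp]
    constructor <;> nlinarith [sq_nonneg (s - 1), mul_nonneg hK0 (sq_nonneg (s - 1))]
  · have hramp : 1 / √3 ≤ ramp s := by
      rw [ramp, abs_of_nonneg hs]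
      exact le_min (le_max_of_le_left (by linarith)) inv_sqrt_three_lt_one.le
    have hlower : 1 / 3 ≤ ramp s ^ 2 := by
      rw [← inv_sqrt_three_sq]
      gcongr
    have hupper : ramp s ^ 2 ≤ 1 := pow_le_one₀ (ramp_nonneg s) (ramp_le_one s)
    have hderiv := hζ.deriv_nonpos h2 h3
    constructor <;> nlinarith

theorem exists_ramp_sq_le (hζ : IsCutoffProfile ζ) (h : HasWeakDeriv ζ ζ₁) (hb : MemLp ζ₁ ⊤) :
    ∃ B, 0 ≤ B ∧ ∀ᵐ s, ramp s ^ 2 ≤ 2 - ζ₁ s ∧ 2 - ζ₁ s ≤ B * ramp s ^ 2 := by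
  have hK0 : 0 ≤ lpNorm ζ₁ ⊤ volume := lpNorm_nonneg
  refine ⟨6 + 3 * lpNorm ζ₁ ⊤ volume, by positivity, ?_⟩
  have hne (a : ℝ) : ∀ᵐ s : ℝ, |s| ≠ a := by
    filter_upwards [Measure.ae_ne volume a, Measure.ae_ne volume (-a)] with s h1 h2 habs
    exact (eq_or_eq_neg_of_abs_eq habs).elim h1 h2
  filter_upwards [ae_le_lpNorm_exponent_top hb, (hζ.isPrimitive h).ae_hasDerivAt, hne 1,
    hne (1 + 1 / √3), hne 2] with s hs hd h1 h2 h3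
  have hderiv : deriv ζ |s| = ζ₁ s := by
    rcases abs_choice s with habs | habs <;> rw [habs]
    · exact hd.deriv
    · rw [hζ.deriv_neg_arg, hd.deriv]
  have hramp : ramp |s| = ramp s := by rw [ramp, abs_abs, ramp]
  rw [← hderiv, ← hramp]
  exact hζ.ramp_sq_le_two_sub_deriv (hderiv ▸ neg_le_of_abs_le hs) hK0 (abs_nonneg s) h1 h2 h3

variable {x : ℝ}

theorem hasDerivAt_cutoffWeight (hζ : IsCutoffProfile ζ) (x : ℝ) :
    HasDerivAt (cutoffWeight ζ) (ζ x) x :=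
  (hζ.continuous.integral_hasStrictDerivAt 0 x).hasDerivAt

theorem cutoffWeight_abs (hζ : IsCutoffProfile ζ) (x : ℝ) :
    cutoffWeight ζ |x| = cutoffWeight ζ x := by
  have hneg : cutoffWeight ζ (-x) = cutoffWeight ζ x := by
    have hcomp := intervalIntegral.integral_comp_neg (a := 0) (b := x) ζ
    simp only [hζ.odd, intervalIntegral.integral_neg, neg_zero] at hcomp
    rw [cutoffWeight, cutoffWeight, intervalIntegral.integral_symm, ← hcomp, neg_neg]
  rcases abs_choice x with h | h <;> rw [h]
  exact hneg

theorem monotoneOn_cutoffWeight (hζ : IsCutoffProfile ζ) : MonotoneOn (cutoffWeight ζ) (Ici 0) := by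
  have hd := hζ.hasDerivAt_cutoffWeight
  refine monotoneOn_of_deriv_nonneg (convex_Ici 0)
    (fun x _ => (hd x).continuousAt.continuousWithinAt)
    (fun x _ => (hd x).differentiableAt.differentiableWithinAt) fun x hx => ?_
  rw [interior_Ici] at hx
  rw [(hd x).deriv]
  exact hζ.nonneg (le_of_lt hx)

theorem cutoffWeight_nonneg (hζ : IsCutoffProfile ζ) (x : ℝ) : 0 ≤ cutoffWeight ζ x := by
  have hzero : cutoffWeight ζ 0 = 0 := intervalIntegral.integral_same
  rw [← hζ.cutoffWeight_abs, ← hzero]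
  exact hζ.monotoneOn_cutoffWeight self_mem_Ici (abs_nonneg x) (abs_nonneg x)

theorem one_le_cutoffWeight (hζ : IsCutoffProfile ζ) (hx : 1 ≤ |x|) : 1 ≤ cutoffWeight ζ x := by
  have hone : cutoffWeight ζ 1 = 1 := by
    rw [cutoffWeight, intervalIntegral.integral_congr (g := fun s => 2 * s),
      intervalIntegral.integral_const_mul, integral_id]
    · norm_num
    · intro s hs
      rw [uIcc_of_le zero_le_one] at hs
      exact hζ.eq_linear s ((abs_of_nonneg hs.1).trans_le hs.2)
  rw [← hζ.cutoffWeight_abs, ← hone]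
  exact hζ.monotoneOn_cutoffWeight (mem_Ici.mpr zero_le_one) (abs_nonneg x) hx

theorem cutoffWeight_eq (hζ : IsCutoffProfile ζ) (hx : 2 ≤ |x|) :
    cutoffWeight ζ x = cutoffWeight ζ 2 := by
  have hint (a b : ℝ) : IntervalIntegrable ζ volume a b := hζ.continuous.intervalIntegrable a b
  have hzero : ∫ s in (2 : ℝ)..|x|, ζ s = 0 := by
    refine intervalIntegral.integral_zero_ae (Eventually.of_forall fun s hs => ?_)
    rw [uIoc_of_le hx] at hs
    exact hζ.eq_zero s (hs.1.le.trans (le_abs_self s))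
  rw [← hζ.cutoffWeight_abs x, cutoffWeight, cutoffWeight,
    ← intervalIntegral.integral_add_adjacent_intervals (hint 0 2) (hint 2 |x|), hzero, add_zero]

theorem cutoffWeight_le (hζ : IsCutoffProfile ζ) (x : ℝ) :
    cutoffWeight ζ x ≤ cutoffWeight ζ 2 := by
  rcases le_total 2 |x| with h | h
  · exact (hζ.cutoffWeight_eq h).le
  · rw [← hζ.cutoffWeight_abs]
    exact hζ.monotoneOn_cutoffWeight (abs_nonneg x) (mem_Ici.mpr zero_le_two) h

end IsCutoffProfile

end CutoffProfile

section Rescaling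

variable {f g φ φ₁ φ₂ φ₃ : ℝ → ℝ} {R : ℝ}

theorem quasiMeasurePreserving_div_const (hR : R ≠ 0) :
    Measure.QuasiMeasurePreserving (fun x : ℝ => x / R) volume volume := by
  simp only [div_eq_inv_mul]
  exact Measure.quasiMeasurePreserving_smul volume (inv_ne_zero hR)

theorem IsPrimitive.comp_div (hf : IsPrimitive f g) (hR : R ≠ 0) (c : ℝ) :
    IsPrimitive (fun x => c * f (x / R)) (fun x => c / R * g (x / R)) := by
  refine ⟨fun x => ?_, fun x y => ?_⟩
  · have hint : IntervalIntegrable (fun y => c / R * g (y / R)) volume (x - 1) (x + 1) := by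
      simpa [div_eq_inv_mul, hR] using
        ((hf.intervalIntegrable ((x - 1) / R) ((x + 1) / R)).comp_mul_left (c := R⁻¹)).const_mul
          (c / R)
    refine ⟨Icc (x - 1) (x + 1), Icc_mem_nhds (by linarith) (by linarith), ?_⟩
    rwa [integrableOn_Icc_iff_integrableOn_Ioc,
      ← intervalIntegrable_iff_integrableOn_Ioc_of_le (by linarith)]
  · rw [intervalIntegral.integral_const_mul, intervalIntegral.integral_comp_div _ hR,
      ← hf.sub_eq, smul_eq_mul, ← mul_assoc, div_mul_cancel₀ _ hR, mul_sub]

theorem HasWeakDeriv.comp_div (h : HasWeakDeriv f g) (hR : R ≠ 0) (c : ℝ) :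
    HasWeakDeriv (fun x => c * f (x / R)) (fun x => c / R * g (x / R)) := by
  obtain ⟨F, hF, hae⟩ := h.exists_isPrimitive
  refine (hF.comp_div hR c).hasWeakDeriv.congr ?_ (ae_eq_refl _)
  filter_upwards [(quasiMeasurePreserving_div_const hR).ae hae] with x hx
  rw [hx]

theorem memLp_top_comp_div (h : MemLp f ⊤) (hR : R ≠ 0) (c : ℝ) :
    MemLp (fun x => c * f (x / R)) ⊤ := by
  have hq := quasiMeasurePreserving_div_const hR
  exact (memLp_top_of_bound (h.1.comp_quasiMeasurePreserving hq) _
    (hq.ae (ae_le_lpNorm_exponent_top h))).const_mul c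

theorem IsW3Inf.comp_div (h : IsW3Inf φ φ₁ φ₂ φ₃) (hR : R ≠ 0) :
    IsW3Inf (fun x => R * φ (x / R)) (fun x => φ₁ (x / R)) (fun x => R⁻¹ * φ₂ (x / R))
      (fun x => (R ^ 2)⁻¹ * φ₃ (x / R)) where
  memLp := memLp_top_comp_div h.memLp hR R
  memLp₁ := by simpa using memLp_top_comp_div h.memLp₁ hR 1
  memLp₂ := memLp_top_comp_div h.memLp₂ hR _
  memLp₃ := memLp_top_comp_div h.memLp₃ hR _
  deriv₁ := by simpa [hR] using h.deriv₁.comp_div hR R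
  deriv₂ := by simpa using h.deriv₂.comp_div hR 1
  deriv₃ := by
    have hscale : R⁻¹ / R = (R ^ 2)⁻¹ := by field_simp
    simpa only [hscale] using h.deriv₃.comp_div hR R⁻¹

end Rescaling

section ExteriorEstimates

open scoped NNReal

theorem integrable_mul_of_memLp_top {φ h : ℝ → ℝ} (hφ : MemLp φ ⊤) (hh : Integrable h) :
    Integrable fun x => φ x * h x :=
  hh.bdd_mul hφ.1 (ae_le_lpNorm_exponent_top hφ)

theorem IsPrimitive.of_lipschitzWith {p : ℝ → ℝ} {K : ℝ≥0} (hp : LipschitzWith K p) :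
    IsPrimitive p (deriv p) := by
  have hderiv : MemLp (deriv p) ⊤ := memLp_top_of_bound
    (measurable_deriv p).aestronglyMeasurable K
    (Eventually.of_forall fun x => norm_deriv_le_of_lipschitz hp)
  exact IsPrimitive.of_absolutelyContinuous (hderiv.locallyIntegrable le_top)
    (fun a b => hp.lipschitzOnWith.absolutelyContinuousOnInterval)
    (hp.ae_differentiableAt_real.mono fun x hx => hx.hasDerivAt)

/-- `p` is a `K`-Lipschitz cut-off function bounded by `1` and vanishing off the closed set `s`. -/
structure IsLipschitzCutoff (K : ℝ≥0) (s : Set ℝ) (p : ℝ → ℝ) : Prop where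
  lipschitzWith : LipschitzWith K p
  norm_le_one : ∀ x, ‖p x‖ ≤ 1
  isClosed : IsClosed s
  eq_zero : ∀ x ∉ s, p x = 0

theorem isLipschitzCutoff_ramp_div {R : ℝ} (hR : 0 < R) :
    IsLipschitzCutoff (Real.toNNReal R⁻¹) {x | R ≤ |x|} (fun x => ramp (x / R)) where
  lipschitzWith := by
    refine LipschitzWith.of_dist_le_mul fun x y => ?_
    have hdist : dist (x / R) (y / R) = R⁻¹ * dist x y := by
      rw [Real.dist_eq, Real.dist_eq, ← sub_div, abs_div, abs_of_pos hR, inv_mul_eq_div]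
    rw [Real.coe_toNNReal R⁻¹ (by positivity), ← hdist]
    simpa using lipschitzWith_ramp.dist_le_mul (x / R) (y / R)
  norm_le_one x := by
    rw [Real.norm_of_nonneg (ramp_nonneg _)]
    exact ramp_le_one _
  isClosed := isClosed_le continuous_const continuous_abs
  eq_zero x hx := by
    refine ramp_eq_zero ?_
    rw [abs_div, abs_of_pos hR]
    exact (div_le_one hR).mpr (not_le.mp hx).le

theorem IsLipschitzCutoff.deriv_eq_zero {K : ℝ≥0} {s : Set ℝ} {p : ℝ → ℝ}
    (hp : IsLipschitzCutoff K s p) {x : ℝ} (hx : x ∉ s) : deriv p x = 0 := by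
  have hzero : p =ᶠ[𝓝 x] fun _ => 0 := by
    filter_upwards [hp.isClosed.isOpen_compl.mem_nhds hx] with y hy using hp.eq_zero y hy
  rw [hzero.deriv_eq, deriv_const]

namespace IsH1Pair

variable {f g : ℝ → ℂ} {p ρ : ℝ → ℝ} {K : ℝ≥0} {s : Set ℝ} {B : ℝ}

theorem integrable_norm_sq (hf : IsH1Pair f g) : Integrable fun x => ‖f x‖ ^ 2 :=
  hf.memLp.integrable_norm_pow two_ne_zero

theorem integrable_norm_sq_deriv (hf : IsH1Pair f g) : Integrable fun x => ‖g x‖ ^ 2 :=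
  hf.memLp_deriv.integrable_norm_pow two_ne_zero

theorem integrable_norm_pow_six (hf : IsH1Pair f g) : Integrable fun x => ‖f x‖ ^ 6 := by
  refine (hf.integrable_norm_sq.const_mul (h1Norm f ^ 4)).mono'
    (hf.continuous.norm.pow 6).aestronglyMeasurable (Eventually.of_forall fun x => ?_)
  rw [norm_pow, norm_norm]
  calc ‖f x‖ ^ 6 = ‖f x‖ ^ 4 * ‖f x‖ ^ 2 := by ring
    _ ≤ h1Norm f ^ 4 * ‖f x‖ ^ 2 := by
      gcongr
      exact hf.norm_le x

theorem memLp_cutoff_mul_deriv (hf : IsH1Pair f g) (hp : IsLipschitzCutoff K s p) :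
    MemLp (fun x => (p x : ℂ) * g x) 2 :=
  hf.memLp_deriv.of_le
    ((Complex.continuous_ofReal.comp
      hp.lipschitzWith.continuous).aestronglyMeasurable.mul hf.memLp_deriv.1)
    (Eventually.of_forall fun x => by
      rw [norm_mul, Complex.norm_real]
      exact mul_le_of_le_one_left (norm_nonneg _) (hp.norm_le_one x))

theorem norm_deriv_cutoff_mul_norm_sq_le (hp : LipschitzWith K p) (x : ℝ) :
    ‖p x * (2 * (g x * starRingEnd ℂ (f x)).re) + deriv p x * ‖f x‖ ^ 2‖ ≤
      2 * (‖(p x : ℂ) * g x‖ * ‖f x‖) + K * ‖f x‖ ^ 2 := by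
  refine (norm_add_le _ _).trans (add_le_add ?_ ?_)
  · have hre := Complex.abs_re_le_norm (g x * starRingEnd ℂ (f x))
    rw [norm_mul, RCLike.norm_conj] at hre
    rw [norm_mul, norm_mul, norm_mul, Complex.norm_real, Real.norm_two,
      Real.norm_eq_abs (Complex.re _)]
    calc ‖p x‖ * (2 * |(g x * starRingEnd ℂ (f x)).re|) ≤ ‖p x‖ * (2 * (‖g x‖ * ‖f x‖)) := by gcongr
      _ = 2 * (‖p x‖ * ‖g x‖ * ‖f x‖) := by ring
  · rw [norm_mul, norm_pow, norm_norm]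
    gcongr
    exact norm_deriv_le_of_lipschitz hp

theorem cutoff_mul_norm_sq_le (hf : IsH1Pair f g) (hp : IsLipschitzCutoff K s p) (x : ℝ) :
    2 * ‖p x * ‖f x‖ ^ 2‖ ≤
      2 * (√(∫ y, p y ^ 2 * ‖g y‖ ^ 2) * √(∫ y in s, ‖f y‖ ^ 2)) + K * ∫ y in s, ‖f y‖ ^ 2 := by
  have hpf : Integrable fun y => p y * ‖f y‖ ^ 2 :=
    hf.integrable_norm_sq.bdd_mul hp.lipschitzWith.continuous.aestronglyMeasurable
      (Eventually.of_forall hp.norm_le_one)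
  have hpg := hf.memLp_cutoff_mul_deriv hp
  have hprod : Integrable fun y => ‖(p y : ℂ) * g y‖ * ‖f y‖ :=
    hpg.norm.integrable_mul hf.memLp.norm
  have hprim := (IsPrimitive.of_lipschitzWith hp.lipschitzWith).smul (𝕜 := ℝ)
    hf.isPrimitive.norm_sq
  simp only [smul_eq_mul] at hprim
  have hbound := norm_deriv_cutoff_mul_norm_sq_le (f := f) (g := g) hp.lipschitzWith
  have hsum : Integrable fun y => 2 * (‖(p y : ℂ) * g y‖ * ‖f y‖) + K * ‖f y‖ ^ 2 :=
    (hprod.const_mul 2).add (hf.integrable_norm_sq.const_mul K)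
  have hderiv := hsum.mono' hprim.locallyIntegrable.aestronglyMeasurable
    (Eventually.of_forall hbound)
  have hpg_sq : ∫ y in s, ‖(p y : ℂ) * g y‖ ^ 2 = ∫ y, p y ^ 2 * ‖g y‖ ^ 2 := by
    simp only [norm_mul, Complex.norm_real, mul_pow, Real.norm_eq_abs, sq_abs]
    exact setIntegral_eq_integral_of_forall_compl_eq_zero fun y hy => by simp [hp.eq_zero y hy]
  have hcs := integral_norm_mul_norm_le_lpNorm_mul_lpNorm (hpg.restrict s) (hf.memLp.restrict s)
  rw [← Real.sqrt_sq (lpNorm_nonneg (f := fun y => (p y : ℂ) * g y)),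
    lpNorm_two_sq (hpg.restrict s), ← Real.sqrt_sq (lpNorm_nonneg (f := f)),
    lpNorm_two_sq (hf.memLp.restrict s), hpg_sq] at hcs
  calc 2 * ‖p x * ‖f x‖ ^ 2‖
      ≤ ∫ y, ‖p y * (2 * (g y * starRingEnd ℂ (f y)).re) + deriv p y * ‖f y‖ ^ 2‖ :=
        hprim.two_mul_norm_le_integral_norm hpf hderiv x
    _ = ∫ y in s, ‖p y * (2 * (g y * starRingEnd ℂ (f y)).re) + deriv p y * ‖f y‖ ^ 2‖ :=
        (setIntegral_eq_integral_of_forall_compl_eq_zero fun y hy => by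
          simp [hp.eq_zero y hy, hp.deriv_eq_zero hy]).symm
    _ ≤ ∫ y in s, (2 * (‖(p y : ℂ) * g y‖ * ‖f y‖) + K * ‖f y‖ ^ 2) :=
        integral_mono hderiv.norm.integrableOn hsum.integrableOn hbound
    _ ≤ _ := by
        rw [integral_add (hprod.const_mul 2).integrableOn
          (hf.integrable_norm_sq.const_mul _).integrableOn, integral_const_mul, integral_const_mul]
        gcongr

theorem sq_cutoff_mul_norm_sq_le (hf : IsH1Pair f g) (hp : IsLipschitzCutoff K s p) (x : ℝ) :
    (p x * ‖f x‖ ^ 2) ^ 2 ≤ (∫ y in s, ‖f y‖ ^ 2) *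
      (2 * (∫ y, p y ^ 2 * ‖g y‖ ^ 2) + K ^ 2 / 2 * ∫ y in s, ‖f y‖ ^ 2) := by
  have hle := hf.cutoff_mul_norm_sq_le hp x
  set A := ∫ y in s, ‖f y‖ ^ 2
  set T := ∫ y, p y ^ 2 * ‖g y‖ ^ 2
  have hA0 : 0 ≤ A := integral_nonneg fun y => sq_nonneg _
  have hT0 : 0 ≤ T := integral_nonneg fun y => by positivity
  calc (p x * ‖f x‖ ^ 2) ^ 2 = ‖p x * ‖f x‖ ^ 2‖ ^ 2 := (Real.norm_eq_abs _ ▸ sq_abs _).symm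
    _ ≤ (√T * √A + K / 2 * A) ^ 2 := by
      gcongr
      linarith
    _ ≤ 2 * (√T * √A) ^ 2 + 2 * (K / 2 * A) ^ 2 := by
      nlinarith [sq_nonneg (√T * √A - K / 2 * A)]
    _ = A * (2 * T + K ^ 2 / 2 * A) := by
      rw [mul_pow, Real.sq_sqrt hT0, Real.sq_sqrt hA0]
      ring

theorem integral_mul_norm_pow_six_le (hf : IsH1Pair f g) (hp : IsLipschitzCutoff K s p)
    (hρ : MemLp ρ ⊤) (hB : 0 ≤ B) (hρp : ∀ᵐ x, p x ^ 2 ≤ ρ x ∧ ρ x ≤ B * p x ^ 2) :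
    ∫ x, ρ x * ‖f x‖ ^ 6 ≤
      B * (∫ x in s, ‖f x‖ ^ 2) ^ 2 *
        (2 * (∫ x, ρ x * ‖g x‖ ^ 2) + K ^ 2 / 2 * ∫ x in s, ‖f x‖ ^ 2) := by
  set A := ∫ x in s, ‖f x‖ ^ 2
  set T := ∫ x, p x ^ 2 * ‖g x‖ ^ 2
  have : 0 ≤ A := integral_nonneg fun x => sq_nonneg _
  have : 0 ≤ T := integral_nonneg fun x => by positivity
  have hT : T ≤ ∫ x, ρ x * ‖g x‖ ^ 2 := by
    refine integral_mono_of_nonneg (Eventually.of_forall fun x => by positivity)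
      (integrable_mul_of_memLp_top hρ hf.integrable_norm_sq_deriv) ?_
    filter_upwards [hρp] with x hx
    gcongr
    exact hx.1
  have hsup := hf.sq_cutoff_mul_norm_sq_le hp
  have hpoint : ∀ᵐ x, ρ x * ‖f x‖ ^ 6 ≤
      s.indicator (fun x => B * (A * (2 * T + K ^ 2 / 2 * A)) * ‖f x‖ ^ 2) x := by
    filter_upwards [hρp] with x hx
    by_cases hxs : x ∈ s
    · rw [indicator_of_mem hxs]
      calc ρ x * ‖f x‖ ^ 6 ≤ B * p x ^ 2 * ‖f x‖ ^ 6 := by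
            gcongr
            exact hx.2
        _ = B * (p x * ‖f x‖ ^ 2) ^ 2 * ‖f x‖ ^ 2 := by ring
        _ ≤ B * (A * (2 * T + K ^ 2 / 2 * A)) * ‖f x‖ ^ 2 := by
          gcongr
          exact hsup x
    · rw [indicator_of_notMem hxs]
      have hle := hx.2
      rw [hp.eq_zero x hxs, zero_pow two_ne_zero, mul_zero] at hle
      exact mul_nonpos_of_nonpos_of_nonneg hle (by positivity)
  calc ∫ x, ρ x * ‖f x‖ ^ 6
      ≤ ∫ x, s.indicator (fun x => B * (A * (2 * T + K ^ 2 / 2 * A)) * ‖f x‖ ^ 2) x :=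
        integral_mono_ae (integrable_mul_of_memLp_top hρ hf.integrable_norm_pow_six)
          ((hf.integrable_norm_sq.const_mul _).indicator hp.isClosed.measurableSet) hpoint
    _ = B * A ^ 2 * (2 * T + K ^ 2 / 2 * A) := by
        rw [integral_indicator hp.isClosed.measurableSet, integral_const_mul]
        ring
    _ ≤ _ := by gcongr

end IsH1Pair

theorem energy_congr_ae {V : ℝ → ℝ} {f f' : ℝ → ℂ} (h : f =ᵐ[volume] f') :
    energy V f = energy V f' := by
  rw [energy, energy, integral_congr_ae (weakDeriv_congr_ae h |>.mono fun x hx => by rw [hx]),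
    integral_congr_ae (h.mono fun x hx => congrArg (V x * ‖·‖ ^ 2) hx),
    integral_congr_ae (h.mono fun x hx => congrArg (‖·‖ ^ 6) hx)]

/-- The value at `f` of the right-hand side of the localized virial identity for the weight with
derivatives `w' = φ`, `w'' = φ₁` and `w⁗ = φ₃`. -/
noncomputable def virialFlux (V φ φ₁ φ₃ : ℝ → ℝ) (f : ℝ → ℂ) : ℝ :=
  4 * (∫ x, φ₁ x * ‖weakDeriv f x‖ ^ 2) - 4 / 3 * (∫ x, φ₁ x * ‖f x‖ ^ 6)
    - (∫ x, φ₃ x * ‖f x‖ ^ 2) - 2 * ∫ x, φ x * deriv V x * ‖f x‖ ^ 2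

namespace MemH1

variable {f : ℝ → ℂ} {p ρ : ℝ → ℝ} {K : ℝ≥0} {s : Set ℝ} {B M : ℝ} {V φ φ₁ φ₃ : ℝ → ℝ}

theorem integrable_norm_sq (hf : MemH1 f) : Integrable fun x => ‖f x‖ ^ 2 :=
  hf.1.integrable_norm_pow two_ne_zero

theorem integrable_norm_sq_weakDeriv (hf : MemH1 f) :
    Integrable fun x => ‖weakDeriv f x‖ ^ 2 :=
  let ⟨_, hF, _⟩ := hf.exists_isH1Pair
  hF.integrable_norm_sq_deriv

theorem integrable_norm_pow_six (hf : MemH1 f) : Integrable fun x => ‖f x‖ ^ 6 :=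
  let ⟨_, hF, hae⟩ := hf.exists_isH1Pair
  hF.integrable_norm_pow_six.congr (hae.mono fun _ hx => congrArg (‖·‖ ^ 6) hx.symm)

theorem integral_mul_norm_pow_six_le_of_small (hf : MemH1 f) (hp : IsLipschitzCutoff K s p)
    (hρ : MemLp ρ ⊤) (hB : 0 ≤ B) (hρp : ∀ᵐ x, p x ^ 2 ≤ ρ x ∧ ρ x ≤ B * p x ^ 2)
    (hs1 : ∫ x in s, ‖f x‖ ^ 2 ≤ 1) (hsB : 2 * B * ∫ x in s, ‖f x‖ ^ 2 ≤ 3) :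
    ∫ x, ρ x * ‖f x‖ ^ 6 ≤ 3 * (∫ x, ρ x * ‖weakDeriv f x‖ ^ 2) + B * K ^ 2 / 2 := by
  obtain ⟨F, hF, hae⟩ := hf.exists_isH1Pair
  have hGN := hF.integral_mul_norm_pow_six_le hp hρ hB hρp
  have hsix : ∫ x, ρ x * ‖F x‖ ^ 6 = ∫ x, ρ x * ‖f x‖ ^ 6 :=
    integral_congr_ae (hae.mono fun x hx => congrArg (ρ x * ‖·‖ ^ 6) hx.symm)
  have hsq : ∫ x in s, ‖F x‖ ^ 2 = ∫ x in s, ‖f x‖ ^ 2 :=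
    integral_congr_ae (ae_restrict_of_ae hae |>.mono fun x hx => congrArg (‖·‖ ^ 2) hx.symm)
  rw [hsix, hsq] at hGN
  set A := ∫ x in s, ‖f x‖ ^ 2
  set T := ∫ x, ρ x * ‖weakDeriv f x‖ ^ 2
  have hA : 0 ≤ A := integral_nonneg fun x => sq_nonneg _
  have hT : 0 ≤ T := integral_nonneg_of_ae <| by
    filter_upwards [hρp] with x hx
    exact mul_nonneg ((sq_nonneg _).trans hx.1) (sq_nonneg _)
  have hkinetic : 2 * B * A * A ≤ 3 := by nlinarith
  calc ∫ x, ρ x * ‖f x‖ ^ 6 ≤ B * A ^ 2 * (2 * T + K ^ 2 / 2 * A) := hGN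
    _ = 2 * B * A * A * T + B * K ^ 2 / 2 * A ^ 3 := by ring
    _ ≤ 3 * T + B * K ^ 2 / 2 * 1 := by
      gcongr
      exact pow_le_one₀ hA hs1
    _ = 3 * T + B * K ^ 2 / 2 := by rw [mul_one]

theorem virialFlux_eq (hf : MemH1 f) (hφ₁ : MemLp φ₁ ⊤) :
    virialFlux V φ φ₁ φ₃ f = 16 * energy V f
      - 4 * (∫ x, (2 - φ₁ x) * ‖weakDeriv f x‖ ^ 2)
      + 4 / 3 * (∫ x, (2 - φ₁ x) * ‖f x‖ ^ 6) - (∫ x, φ₃ x * ‖f x‖ ^ 2)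
      - 2 * ((∫ x, φ x * deriv V x * ‖f x‖ ^ 2) + 4 * ∫ x, V x * ‖f x‖ ^ 2) := by
  have hsub {h : ℝ → ℝ} (hh : Integrable h) :
      ∫ x, (2 - φ₁ x) * h x = 2 * (∫ x, h x) - ∫ x, φ₁ x * h x := by
    simp only [sub_mul]
    rw [integral_sub (hh.const_mul 2) (integrable_mul_of_memLp_top hφ₁ hh), integral_const_mul]
  rw [hsub hf.integrable_norm_sq_weakDeriv, hsub hf.integrable_norm_pow_six, virialFlux, energy]
  ring

theorem virialFlux_le (hf : MemH1 f) (hp : IsLipschitzCutoff K s p) (hφ₁ : MemLp φ₁ ⊤)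
    (hφ₃ : ∀ᵐ x, ‖φ₃ x‖ ≤ M) (hB : 0 ≤ B)
    (hφp : ∀ᵐ x, p x ^ 2 ≤ 2 - φ₁ x ∧ 2 - φ₁ x ≤ B * p x ^ 2)
    (hV : Integrable fun x => V x * ‖f x‖ ^ 2)
    (hφV : Integrable fun x => φ x * deriv V x * ‖f x‖ ^ 2)
    (hsign : ∀ᵐ x, -φ x * deriv V x - 4 * V x ≤ 0)
    (hs1 : ∫ x in s, ‖f x‖ ^ 2 ≤ 1) (hsB : 2 * B * ∫ x in s, ‖f x‖ ^ 2 ≤ 3) :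
    virialFlux V φ φ₁ φ₃ f ≤
      16 * energy V f + (2 / 3 * B * K ^ 2 + M * mass f) := by
  have hρ : MemLp (fun x => 2 - φ₁ x) ⊤ := (memLp_top_const 2).sub hφ₁
  have hsix := hf.integral_mul_norm_pow_six_le_of_small hp hρ hB hφp hs1 hsB
  have hmass : ‖∫ x, φ₃ x * ‖f x‖ ^ 2‖ ≤ M * mass f := by
    rw [mass, ← integral_const_mul]
    refine norm_integral_le_of_norm_le (hf.integrable_norm_sq.const_mul _) ?_
    filter_upwards [hφ₃] with x hx
    rw [norm_mul, norm_pow, norm_norm]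
    gcongr
  have hpotential :
      0 ≤ (∫ x, φ x * deriv V x * ‖f x‖ ^ 2) + 4 * ∫ x, V x * ‖f x‖ ^ 2 := by
    rw [← integral_const_mul, ← integral_add hφV (hV.const_mul 4)]
    refine integral_nonneg_of_ae ?_
    filter_upwards [hsign] with x hx
    have hx' : 0 ≤ φ x * deriv V x + 4 * V x := by linarith
    exact (mul_nonneg hx' (sq_nonneg ‖f x‖)).trans_eq (by ring)
  rw [hf.virialFlux_eq hφ₁]
  linarith [neg_le_of_abs_le hmass]

end MemH1

end ExteriorEstimates

section MaximalSolution

variable {V : ℝ → ℝ} {u₀ f f' : ℝ → ℂ} {J : Set ℝ} {u v : ℝ → ℝ → ℂ}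
  {Smin Smax Tmin Tmax : EReal}

theorem ae_eq_of_integral_mul_schwartz (hf : LocallyIntegrable f) (hf' : LocallyIntegrable f')
    (h : ∀ ψ : 𝓢(ℝ, ℂ), ∫ x, f x * ψ x = ∫ x, f' x * ψ x) : f =ᵐ[volume] f' := by
  refine ae_eq_of_integral_contDiff_smul_eq hf hf' fun g hg hgc => ?_
  have hc : HasCompactSupport (fun x => (g x : ℂ)) := hgc.comp_left Complex.ofReal_zero
  have htest : ∫ x, f x * (g x : ℂ) = ∫ x, f' x * (g x : ℂ) :=
    h (hc.toSchwartzMap (Complex.ofRealCLM.contDiff.comp hg))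
  simpa only [Complex.real_smul, mul_comm] using htest

theorem integral_mul_congr_ae (h : f =ᵐ[volume] f') (k : ℝ → ℂ) :
    ∫ x, f x * k x = ∫ x, f' x * k x :=
  integral_congr_ae (h.mono fun x hx => congrArg (· * k x) hx)

theorem integral_forcing_mul_congr_ae (h : f =ᵐ[volume] f') (k : ℝ → ℂ) :
    ∫ x, forcing V f x * k x = ∫ x, forcing V f' x * k x :=
  integral_mul_congr_ae (h.mono fun x hx => by rw [forcing, forcing, hx]) k

namespace IsSolution

theorem integral_initial_mul (h : IsSolution V u₀ J u) (ψ : 𝓢(ℝ, ℂ)) :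
    ∫ x, u 0 x * ψ x = ∫ x, u₀ x * ψ x := by
  simpa [freeGroup_zero] using h.duhamel 0 h.zero_mem ψ

theorem initial_ae_eq (h : IsSolution V u₀ J u) (hu₀ : LocallyIntegrable u₀) :
    u 0 =ᵐ[volume] u₀ :=
  ae_eq_of_integral_mul_schwartz ((h.memH1 0 h.zero_mem).1.locallyIntegrable one_le_two) hu₀
    h.integral_initial_mul

theorem exists_isWeakFlow (h : IsSolution V u₀ J u) (hJ : IsOpen J)
    (hV : Integrable fun x => V x * decay x) :
    ∃ U, IsWeakFlow V J U (fun t => weakDeriv (u t)) ∧ ∀ t ∈ J, u t =ᵐ[volume] U t := by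
  choose! U hpair hae using fun t ht => (h.memH1 t ht).exists_isH1Pair
  have hforcing {s t : ℝ} (ht : t ∈ J) (hs : s ∈ uIcc 0 t) (ψ : 𝓢(ℝ, ℂ)) :
      ∫ x, forcing V (u s) x * ψ x = ∫ x, forcing V (U s) x * ψ x :=
    integral_forcing_mul_congr_ae (hae s (h.ordConnected.uIcc_subset h.zero_mem ht hs)) ψ
  refine ⟨U, ⟨hJ, hpair, fun t₀ ht₀ => ?_, hV, fun t ht ψ => ?_,
    fun t ht ψ => ?_⟩, hae⟩
  · have hcont := h.continuous t₀ ht₀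
    rw [hJ.nhdsWithin_eq ht₀] at hcont
    refine hcont.congr' ?_
    filter_upwards [hJ.mem_nhds ht₀] with t ht
    exact h1Norm_congr_ae ((hae t ht).sub (hae t₀ ht₀))
  · exact (h.intervalIntegrable_forcing t ht ψ).congr fun s hs =>
      hforcing ht (uIoc_subset_uIcc hs) _
  · rw [← integral_mul_congr_ae (hae t ht), h.duhamel t ht ψ, ← h.integral_initial_mul,
      integral_mul_congr_ae (hae 0 h.zero_mem),
      intervalIntegral.integral_congr fun s hs => hforcing ht hs _]

end IsSolution

theorem isH1Pair_inv_one_add_sq :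
    IsH1Pair (fun x => (((1 + x ^ 2)⁻¹ : ℝ) : ℂ)) (fun x => ((-(2 * x) * decay x : ℝ) : ℂ)) := by
  have hcont : Continuous fun x : ℝ => -(2 * x) * decay x :=
    (continuous_const.mul continuous_id).neg.mul continuous_decay
  have hderiv (x : ℝ) : HasDerivAt (fun x : ℝ => (1 + x ^ 2)⁻¹) (-(2 * x) * decay x) x := by
    have hsq : HasDerivAt (fun x : ℝ => 1 + x ^ 2) (2 * x) x := by
      simpa using (hasDerivAt_pow 2 x).const_add 1
    exact (hsq.inv (by positivity)).congr_deriv (by rw [decay, div_eq_mul_inv])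
  have hprim := (IsPrimitive.of_hasDerivAt hderiv hcont).ofReal
  have hmem : MemLp (fun x : ℝ => (((1 + x ^ 2)⁻¹ : ℝ) : ℂ)) 2 := by
    refine (memLp_two_iff_integrable_sq_norm hprim.continuous.aestronglyMeasurable).mpr ?_
    simp only [Complex.norm_real, Real.norm_eq_abs, sq_abs, inv_pow]
    exact integrable_decay
  refine ⟨hprim, hmem, hmem.of_le (Complex.continuous_ofReal.comp hcont).aestronglyMeasurable
    (Eventually.of_forall fun x => ?_)⟩
  have htwo : |2 * x| ≤ 1 + x ^ 2 := by
    rw [abs_le]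
    constructor <;> nlinarith [sq_nonneg (x - 1), sq_nonneg (x + 1)]
  rw [Complex.norm_real, Complex.norm_real, norm_mul, norm_neg, Real.norm_eq_abs,
    Real.norm_of_nonneg (decay_pos x).le, Real.norm_of_nonneg (by positivity)]
  calc |2 * x| * decay x ≤ (1 + x ^ 2) * decay x :=
        mul_le_mul_of_nonneg_right htwo (decay_pos x).le
    _ = (1 + x ^ 2)⁻¹ := by rw [decay]; field_simp

theorem LocallyWellPosed.integrable_mul_decay (h : LocallyWellPosed V) :
    Integrable fun x => V x * decay x := by
  have hpair := isH1Pair_inv_one_add_sq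
  obtain ⟨Tmin, Tmax, u, hu, -, -, -, hcons⟩ := h _ hpair.memH1
  refine (hcons 0 hu.isSolution.zero_mem).2.1.congr ?_
  filter_upwards [hu.isSolution.initial_ae_eq hpair.continuous.locallyIntegrable] with x hx
  rw [hx, Complex.norm_real, Real.norm_eq_abs, sq_abs, decay, inv_pow]

theorem isOpen_timeInterval (Tmin Tmax : EReal) : IsOpen (timeInterval Tmin Tmax) :=
  isOpen_Ioo.preimage continuous_coe_real_ereal

theorem le_of_timeInterval_subset (h0 : (0 : ℝ) ∈ timeInterval Smin Smax)
    (h : timeInterval Smin Smax ⊆ timeInterval Tmin Tmax) : Tmin ≤ Smin ∧ Smax ≤ Tmax := by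
  refine ⟨le_of_not_gt fun hlt => ?_, le_of_not_gt fun hlt => ?_⟩
  · obtain ⟨r, hr, hr'⟩ := EReal.lt_iff_exists_real_btwn.mp (lt_min hlt h0.1)
    have hmem : r ∈ timeInterval Smin Smax := ⟨hr, (lt_min_iff.mp hr').2.trans h0.2⟩
    exact (h hmem).1.not_gt (lt_min_iff.mp hr').1
  · obtain ⟨r, hr', hr⟩ := EReal.lt_iff_exists_real_btwn.mp (max_lt hlt h0.2)
    have hmem : r ∈ timeInterval Smin Smax := ⟨h0.1.trans (max_lt_iff.mp hr').2, hr⟩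
    exact (h hmem).2.not_gt (max_lt_iff.mp hr').1

theorem eventually_mem_timeInterval_of_ne_top (h0 : (0 : ℝ) ∈ timeInterval Tmin Tmax)
    (hT : Tmax ≠ ⊤) : ∀ᶠ t in 𝓝[<] Tmax.toReal, t ∈ timeInterval Tmin Tmax := by
  have hcoe : (Tmax.toReal : EReal) = Tmax :=
    EReal.coe_toReal hT ((EReal.bot_lt_coe 0).trans h0.2).ne'
  have hpos : 0 < Tmax.toReal := by rw [← EReal.coe_lt_coe_iff, hcoe]; exact h0.2
  filter_upwards [Ioo_mem_nhdsLT hpos] with t ht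
  exact ⟨h0.1.trans (EReal.coe_lt_coe_iff.mpr ht.1), hcoe ▸ EReal.coe_lt_coe_iff.mpr ht.2⟩

theorem eventually_mem_timeInterval_of_ne_bot (h0 : (0 : ℝ) ∈ timeInterval Tmin Tmax)
    (hT : Tmin ≠ ⊥) : ∀ᶠ t in 𝓝[>] Tmin.toReal, t ∈ timeInterval Tmin Tmax := by
  have hcoe : (Tmin.toReal : EReal) = Tmin :=
    EReal.coe_toReal (h0.1.trans (EReal.coe_lt_top 0)).ne hT
  have hneg : Tmin.toReal < 0 := by rw [← EReal.coe_lt_coe_iff, hcoe]; exact h0.1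
  filter_upwards [Ioo_mem_nhdsGT hneg] with t ht
  exact ⟨hcoe ▸ EReal.coe_lt_coe_iff.mpr ht.1, (EReal.coe_lt_coe_iff.mpr ht.2).trans h0.2⟩

namespace IsMaximalSolution

theorem endpoints_eq (hu : IsMaximalSolution V u₀ Tmin Tmax u)
    (hv : IsMaximalSolution V u₀ Smin Smax v) : Smin = Tmin ∧ Smax = Tmax := by
  obtain ⟨hmin, hmax⟩ := le_of_timeInterval_subset hu.isSolution.zero_mem
    (hv.unique _ _ hu.isSolution).1
  obtain ⟨hmin', hmax'⟩ := le_of_timeInterval_subset hv.isSolution.zero_mem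
    (hu.unique _ _ hv.isSolution).1
  exact ⟨hmin.antisymm hmin', hmax'.antisymm hmax⟩

theorem blowUp_and_conservation (hu : IsMaximalSolution V u₀ Tmin Tmax u) (hu₀ : MemH1 u₀)
    (h : LocallyWellPosed V) :
    (Tmin ≠ ⊥ → NormBlowsUpAtMin Tmin u) ∧ (Tmax ≠ ⊤ → NormBlowsUpAtMax Tmax u) ∧
      ∀ t ∈ timeInterval Tmin Tmax, mass (u t) = mass u₀ ∧
        Integrable (fun x => V x * ‖u t x‖ ^ 2) ∧ energy V (u t) = energy V u₀ := by
  obtain ⟨Smin, Smax, v, hv, -, hmin, hmax, hcons⟩ := h u₀ hu₀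
  obtain ⟨rfl, rfl⟩ := hu.endpoints_eq hv
  have hae := (hv.unique _ _ hu.isSolution).2
  have h0 := hu.isSolution.zero_mem
  have hnorm {t : ℝ} (ht : t ∈ timeInterval Smin Smax) : h1Norm (v t) = h1Norm (u t) :=
    (h1Norm_congr_ae (hae t ht)).symm
  refine ⟨fun hb => ?_, fun ht => ?_, fun t ht => ?_⟩
  · exact (hmin hb).congr' ((eventually_mem_timeInterval_of_ne_bot h0 hb).mono fun _ => hnorm)
  · exact (hmax ht).congr' ((eventually_mem_timeInterval_of_ne_top h0 ht).mono fun _ => hnorm)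
  · obtain ⟨hmass, hint, henergy⟩ := hcons t ht
    have hsq : ∀ᵐ x, ‖v t x‖ ^ 2 = ‖u t x‖ ^ 2 :=
      (hae t ht).mono fun x hx => congrArg (‖·‖ ^ 2) hx.symm
    exact ⟨(integral_congr_ae hsq).symm.trans hmass,
      hint.congr (hsq.mono fun x hx => congrArg (V x * ·) hx),
      (energy_congr_ae (hae t ht)).trans henergy⟩

end IsMaximalSolution

end MaximalSolution

section Concavity

variable {I I₁ I₂ : ℝ → ℝ} {A c T : ℝ} {J : Set ℝ}

theorem le_quadratic_of_deriv_deriv_le (hT : 0 ≤ T)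
    (hI : ∀ t ∈ Icc 0 T, HasDerivAt I (I₁ t) t) (hI₁ : ∀ t ∈ Icc 0 T, HasDerivAt I₁ (I₂ t) t)
    (hc : ∀ t ∈ Ioo 0 T, I₂ t ≤ -c) : I T ≤ I 0 + I₁ 0 * T - c / 2 * T ^ 2 := by
  have hslope : AntitoneOn (fun t => I₁ t + c * t) (Icc 0 T) := by
    have hd (t : ℝ) (ht : t ∈ Icc 0 T) : HasDerivAt (fun t => I₁ t + c * t) (I₂ t + c) t :=
      ((hI₁ t ht).add ((hasDerivAt_id t).const_mul c)).congr_deriv (by rw [mul_one])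
    refine antitoneOn_of_hasDerivWithinAt_nonpos (convex_Icc 0 T)
      (fun t ht => (hd t ht).continuousAt.continuousWithinAt)
      (fun t ht => (hd t (interior_subset ht)).hasDerivWithinAt) fun t ht => ?_
    rw [interior_Icc] at ht
    linarith [hc t ht]
  have hdefect : AntitoneOn (fun t => I t - (I₁ 0 * t - c / 2 * t ^ 2)) (Icc 0 T) := by
    have hd (t : ℝ) (ht : t ∈ Icc 0 T) : HasDerivAt (fun t => I t - (I₁ 0 * t - c / 2 * t ^ 2))
        (I₁ t - (I₁ 0 - c * t)) t := by
      refine ((hI t ht).sub (((hasDerivAt_id t).const_mul (I₁ 0)).sub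
        ((hasDerivAt_pow 2 t).const_mul (c / 2)))).congr_deriv ?_
      norm_num
      ring
    refine antitoneOn_of_hasDerivWithinAt_nonpos (convex_Icc 0 T)
      (fun t ht => (hd t ht).continuousAt.continuousWithinAt)
      (fun t ht => (hd t (interior_subset ht)).hasDerivWithinAt) fun t ht => ?_
    have ht' := interior_subset ht
    have hle := hslope (left_mem_Icc.mpr hT) ht' ht'.1
    simp only [mul_zero, add_zero] at hle
    linarith
  have hle := hdefect (left_mem_Icc.mpr hT) (right_mem_Icc.mpr hT) hT
  norm_num at hle
  linarith

theorem lt_of_deriv_deriv_le_of_le (hc : 0 < c)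
    (hI : ∀ t, 0 ≤ t → HasDerivAt I (I₁ t) t) (hI₁ : ∀ t, 0 ≤ t → HasDerivAt I₁ (I₂ t) t)
    (hI₂ : ∀ t, 0 ≤ t → I t ≤ A → I₂ t ≤ -c) (hA : I 0 + I₁ 0 ^ 2 / (2 * c) < A) (hT : 0 ≤ T) :
    I T < A := by
  have hparabola (t : ℝ) : I 0 + I₁ 0 * t - c / 2 * t ^ 2 < A := by
    have hvertex : I₁ 0 * t - c / 2 * t ^ 2 ≤ I₁ 0 ^ 2 / (2 * c) := by
      rw [le_div_iff₀ (by positivity)]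
      nlinarith [sq_nonneg (I₁ 0 - c * t)]
    linarith
  by_contra! hlt
  have hcont : ContinuousOn I (Icc 0 T) := fun t ht => (hI t ht.1).continuousAt.continuousWithinAt
  have hcompact : IsCompact (Icc 0 T ∩ I ⁻¹' Ici A) :=
    isCompact_Icc.of_isClosed_subset
      (hcont.preimage_isClosed_of_isClosed isClosed_Icc isClosed_Ici) inter_subset_left
  obtain ⟨s, ⟨hs, hAs⟩, hfirst⟩ := hcompact.exists_isLeast ⟨T, right_mem_Icc.mpr hT, hlt⟩
  have hbelow (t : ℝ) (ht : t ∈ Ioo 0 s) : I t ≤ A :=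
    le_of_not_ge fun hAt => ht.2.not_ge (hfirst ⟨⟨ht.1.le, ht.2.le.trans hs.2⟩, hAt⟩)
  have hle := le_quadratic_of_deriv_deriv_le hs.1 (fun t ht => hI t ht.1)
    (fun t ht => hI₁ t ht.1) fun t ht => hI₂ t ht.1.le (hbelow t ht)
  exact (hAs.trans hle).not_gt (hparabola s)

/-- The hypothesis on `I 0` and `I₁ 0` keeps the parabola `I 0 + I₁ 0 * t - c / 2 * t ^ 2` below the
level `A`, so that the uniform concavity, assumed only below `A`, propagates. -/
theorem not_Ici_subset_of_deriv_deriv_le (hc : 0 < c) (h0 : ∀ t, 0 ≤ I t)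
    (hI : ∀ t ∈ J, HasDerivAt I (I₁ t) t) (hI₁ : ∀ t ∈ J, HasDerivAt I₁ (I₂ t) t)
    (hI₂ : ∀ t ∈ J, I t ≤ A → I₂ t ≤ -c) (hA : I 0 + I₁ 0 ^ 2 / (2 * c) < A) :
    ¬Ici 0 ⊆ J := by
  intro hJ
  have hquadratic {t : ℝ} (ht : 0 ≤ t) : 0 ≤ I 0 + t * (I₁ 0 - c / 2 * t) := by
    have hle := le_quadratic_of_deriv_deriv_le ht (fun s hs => hI s (hJ hs.1))
      (fun s hs => hI₁ s (hJ hs.1)) fun s hs => hI₂ s (hJ hs.1.le)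
        (lt_of_deriv_deriv_le_of_le hc (fun r hr => hI r (hJ hr)) (fun r hr => hI₁ r (hJ hr))
          (fun r hr => hI₂ r (hJ hr)) hA hs.1.le).le
    linarith [h0 t]
  have hslope : Tendsto (fun t => I₁ 0 - c / 2 * t) atTop atBot :=
    tendsto_atBot_add_const_left _ _
      (tendsto_neg_atTop_atBot.comp (tendsto_id.const_mul_atTop (half_pos hc)))
  have hbot := tendsto_atBot_add_const_left _ (I 0) (tendsto_id.atTop_mul_atBot₀ hslope)
  obtain ⟨t, ht, hneg⟩ := ((eventually_ge_atTop 0).and (hbot.eventually_lt_atBot 0)).exists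
  exact (hquadratic ht).not_gt hneg

theorem not_Iic_subset_of_deriv_deriv_le (hc : 0 < c) (h0 : ∀ t, 0 ≤ I t)
    (hI : ∀ t ∈ J, HasDerivAt I (I₁ t) t) (hI₁ : ∀ t ∈ J, HasDerivAt I₁ (I₂ t) t)
    (hI₂ : ∀ t ∈ J, I t ≤ A → I₂ t ≤ -c) (hA : I 0 + I₁ 0 ^ 2 / (2 * c) < A) :
    ¬Iic 0 ⊆ J := by
  have hreflected := not_Ici_subset_of_deriv_deriv_le (J := Neg.neg ⁻¹' J)
    (I := fun t => I (-t)) (I₁ := fun t => -I₁ (-t)) (I₂ := fun t => I₂ (-t)) hc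
    (fun t => h0 (-t)) (fun t ht => ((hI _ ht).comp t (hasDerivAt_neg t)).congr_deriv (by ring))
    (fun t ht => ((hI₁ _ ht).comp t (hasDerivAt_neg t)).neg.congr_deriv (by ring))
    (fun t ht => hI₂ _ ht) (by simpa using hA)
  exact fun hJ => hreflected fun t ht => hJ (neg_nonpos.mpr (mem_Ici.mp ht))

end Concavity

section CutoffMass

variable {V ζ ζ₁ ζ₂ ζ₃ : ℝ → ℝ} {f f' : ℝ → ℂ} {R t t₀ : ℝ} {J : Set ℝ} {u U G : ℝ → ℝ → ℂ}

/-- The mass of `f` weighted by `𝒳(x / R)`. It controls the mass in `|x| ≥ R`, and `R ^ 2` times it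
is the localized virial quantity for the cut-off at scale `R`. -/
noncomputable def cutoffMass (ζ : ℝ → ℝ) (R : ℝ) (f : ℝ → ℂ) : ℝ :=
  ∫ x, cutoffWeight ζ (x / R) * ‖f x‖ ^ 2

theorem cutoffMass_congr_ae (h : f =ᵐ[volume] f') : cutoffMass ζ R f = cutoffMass ζ R f' :=
  integral_congr_ae (h.mono fun x hx => congrArg (cutoffWeight ζ (x / R) * ‖·‖ ^ 2) hx)

theorem mass_congr_ae (h : f =ᵐ[volume] f') : mass f = mass f' :=
  integral_congr_ae (h.mono fun _ hx => congrArg (‖·‖ ^ 2) hx)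

theorem virial_comp_div (hR : R ≠ 0) (ζ : ℝ → ℝ) (u : ℝ → ℝ → ℂ) (t : ℝ) :
    virial (fun x => R * ζ (x / R)) u t = R ^ 2 * cutoffMass ζ R (u t) := by
  have hweight (x : ℝ) : ∫ s in (0 : ℝ)..x, R * ζ (s / R) = R ^ 2 * cutoffWeight ζ (x / R) := by
    rw [intervalIntegral.integral_const_mul, intervalIntegral.integral_comp_div _ hR, zero_div,
      cutoffWeight, smul_eq_mul, sq, mul_assoc]
  rw [virial, cutoffMass, ← integral_const_mul]
  simp only [hweight, mul_assoc]

theorem tendsto_integral_comp_div_smul {E : Type*} [NormedAddCommGroup E] [NormedSpace ℝ E]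
    {k : ℝ → ℝ} {h : ℝ → E} {C : ℝ} (hk : Continuous k) (hC : ∀ x, ‖k x‖ ≤ C) (hh : Integrable h) :
    Tendsto (fun R : ℝ => ∫ x, k (x / R) • h x) atTop (𝓝 (∫ x, k 0 • h x)) := by
  refine tendsto_integral_filter_of_dominated_convergence (fun x => C * ‖h x‖)
    (Eventually.of_forall fun R =>
      (hk.comp (continuous_id.div_const R)).aestronglyMeasurable.smul hh.1)
    (Eventually.of_forall fun R => Eventually.of_forall fun x => ?_) (hh.norm.const_mul C)
    (Eventually.of_forall fun x => ?_)
  · rw [norm_smul]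
    gcongr
    exact hC _
  · exact ((hk.tendsto 0).comp (tendsto_const_nhds.div_atTop tendsto_id)).smul_const (h x)

namespace IsCutoffProfile

theorem hasCompactSupport (hζ : IsCutoffProfile ζ) : HasCompactSupport ζ :=
  hasCompactSupport_of_forall_abs_ge hζ.eq_zero

theorem hasCompactSupport_comp_div (hζ : IsCutoffProfile ζ) (hR : 0 < R) :
    HasCompactSupport fun x => R * ζ (x / R) :=
  hasCompactSupport_of_forall_abs_ge (a := 2 * R) fun x hx => by
    rw [hζ.eq_zero, mul_zero]
    rwa [abs_div, abs_of_pos hR, le_div_iff₀ hR]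

theorem norm_cutoffWeight_le (hζ : IsCutoffProfile ζ) (x : ℝ) :
    ‖cutoffWeight ζ x‖ ≤ cutoffWeight ζ 2 :=
  (Real.norm_of_nonneg (hζ.cutoffWeight_nonneg x)).trans_le (hζ.cutoffWeight_le x)

theorem continuous_cutoffWeight (hζ : IsCutoffProfile ζ) : Continuous (cutoffWeight ζ) :=
  continuous_iff_continuousAt.mpr fun x => (hζ.hasDerivAt_cutoffWeight x).continuousAt

theorem cutoffMass_nonneg (hζ : IsCutoffProfile ζ) (R : ℝ) (f : ℝ → ℂ) : 0 ≤ cutoffMass ζ R f :=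
  integral_nonneg fun _ => mul_nonneg (hζ.cutoffWeight_nonneg _) (sq_nonneg _)

theorem integrable_cutoffWeight_mul (hζ : IsCutoffProfile ζ) (hf : MemLp f 2) (R : ℝ) :
    Integrable fun x => cutoffWeight ζ (x / R) * ‖f x‖ ^ 2 :=
  (hf.integrable_norm_pow two_ne_zero).bdd_mul
    (hζ.continuous_cutoffWeight.comp (continuous_id.div_const R)).aestronglyMeasurable
    (Eventually.of_forall fun _ => hζ.norm_cutoffWeight_le _)

theorem setIntegral_norm_sq_le_cutoffMass (hζ : IsCutoffProfile ζ) (hf : MemLp f 2) (hR : 0 < R) :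
    ∫ x in {x | R ≤ |x|}, ‖f x‖ ^ 2 ≤ cutoffMass ζ R f := by
  have hint := hζ.integrable_cutoffWeight_mul hf R
  have hs : MeasurableSet {x : ℝ | R ≤ |x|} := measurableSet_le measurable_const measurable_norm
  refine (setIntegral_mono_on (hf.integrable_norm_pow two_ne_zero).integrableOn hint.integrableOn
    hs fun x hx => ?_).trans (setIntegral_le_integral hint (Eventually.of_forall fun x =>
      mul_nonneg (hζ.cutoffWeight_nonneg _) (sq_nonneg _)))
  refine le_mul_of_one_le_left (sq_nonneg _) (hζ.one_le_cutoffWeight ?_)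
  rwa [abs_div, abs_of_pos hR, one_le_div hR]

theorem tendsto_cutoffMass (hζ : IsCutoffProfile ζ) (hf : MemLp f 2) :
    Tendsto (fun R => cutoffMass ζ R f) atTop (𝓝 0) := by
  have h := tendsto_integral_comp_div_smul hζ.continuous_cutoffWeight hζ.norm_cutoffWeight_le
    (hf.integrable_norm_pow two_ne_zero)
  have hzero : cutoffWeight ζ 0 = 0 := intervalIntegral.integral_same
  simpa [cutoffMass, hzero] using h

theorem tendsto_integral_comp_div_smul (hζ : IsCutoffProfile ζ) (hf : Integrable f) :
    Tendsto (fun R => ∫ x, ζ (x / R) • f x) atTop (𝓝 0) := by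
  obtain ⟨C, hC⟩ := hζ.hasCompactSupport.exists_bound_of_continuous hζ.continuous
  have hzero : ζ 0 = 0 := by simpa using hζ.eq_linear 0 (by simp)
  simpa [hzero] using NLS.tendsto_integral_comp_div_smul hζ.continuous hC hf

theorem virialFlux_comp_div_le (hζ : IsCutoffProfile ζ) (hW : IsW3Inf ζ ζ₁ ζ₂ ζ₃) {B : ℝ}
    (hB : 0 ≤ B) (hramp : ∀ᵐ s, ramp s ^ 2 ≤ 2 - ζ₁ s ∧ 2 - ζ₁ s ≤ B * ramp s ^ 2) (hR : 0 < R)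
    (hf : MemH1 f) (hV : Integrable fun x => V x * ‖f x‖ ^ 2)
    (hζV : Integrable fun x => R * ζ (x / R) * deriv V x * ‖f x‖ ^ 2)
    (hsign : ∀ᵐ x, -R * deriv (cutoffWeight ζ) (x / R) * deriv V x - 4 * V x ≤ 0)
    (h1 : cutoffMass ζ R f ≤ 1) (hB3 : 2 * B * cutoffMass ζ R f ≤ 3) :
    virialFlux V (fun x => R * ζ (x / R)) (fun x => ζ₁ (x / R)) (fun x => (R ^ 2)⁻¹ * ζ₃ (x / R)) f
      ≤ 16 * energy V f + (2 / 3 * B + lpNorm ζ₃ ⊤ volume * mass f) / R ^ 2 := by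
  have hq := quasiMeasurePreserving_div_const hR.ne'
  have hζ₃ : ∀ᵐ x, ‖(R ^ 2)⁻¹ * ζ₃ (x / R)‖ ≤ (R ^ 2)⁻¹ * lpNorm ζ₃ ⊤ volume := by
    filter_upwards [hq.ae (ae_le_lpNorm_exponent_top hW.memLp₃)] with x hx
    rw [norm_mul, Real.norm_of_nonneg (by positivity)]
    gcongr
  have hsign' : ∀ᵐ x, -(R * ζ (x / R)) * deriv V x - 4 * V x ≤ 0 := by
    filter_upwards [hsign] with x hx
    rwa [(hζ.hasDerivAt_cutoffWeight _).deriv, neg_mul] at hx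
  have hmass := hζ.setIntegral_norm_sq_le_cutoffMass hf.1 hR
  refine (hf.virialFlux_le (isLipschitzCutoff_ramp_div hR) (hW.comp_div hR.ne').memLp₁ hζ₃ hB
    (hq.ae hramp) hV hζV hsign' (hmass.trans h1)
    ((mul_le_mul_of_nonneg_left hmass (by positivity)).trans hB3)).trans_eq ?_
  rw [Real.coe_toNNReal _ (inv_nonneg.mpr hR.le)]
  field_simp

theorem exists_eventually_virialFlux_comp_div_le (hζ : IsCutoffProfile ζ)
    (hW : IsW3Inf ζ ζ₁ ζ₂ ζ₃) {E : ℝ} (hE : E < 0) (M : ℝ)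
    (hsign : ∀ R : ℝ, 0 < R → ∀ᵐ x,
      -R * deriv (cutoffWeight ζ) (x / R) * deriv V x - 4 * V x ≤ 0) :
    ∃ a > 0, ∀ᶠ R in atTop, ∀ f : ℝ → ℂ, MemH1 f → mass f = M → energy V f = E →
      Integrable (fun x => V x * ‖f x‖ ^ 2) →
      Integrable (fun x => R * ζ (x / R) * deriv V x * ‖f x‖ ^ 2) → cutoffMass ζ R f ≤ a →
      virialFlux V (fun x => R * ζ (x / R)) (fun x => ζ₁ (x / R))
        (fun x => (R ^ 2)⁻¹ * ζ₃ (x / R)) f ≤ 8 * E := by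
  obtain ⟨B, hB, hramp⟩ := hζ.exists_ramp_sq_le hW.deriv₁ hW.memLp₁
  have hremainder : Tendsto (fun R : ℝ => (2 / 3 * B + lpNorm ζ₃ ⊤ volume * M) / R ^ 2) atTop
      (𝓝 0) := tendsto_const_nhds.div_atTop (tendsto_pow_atTop two_ne_zero)
  refine ⟨3 / (2 * B + 3), by positivity, ?_⟩
  filter_upwards [eventually_gt_atTop 0, hremainder.eventually_lt_const (by linarith : 0 < -8 * E)]
    with R hR hsmall f hf hmass henergy hV hζV hcutoff
  have ha : cutoffMass ζ R f * (2 * B + 3) ≤ 3 := (le_div_iff₀ (by positivity)).mp hcutoff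
  have hnonneg := hζ.cutoffMass_nonneg R f
  have hflux := hζ.virialFlux_comp_div_le hW hB hramp hR hf hV hζV (hsign R hR) (by nlinarith)
    (by nlinarith)
  rw [hmass, henergy] at hflux
  linarith

end IsCutoffProfile

theorem IsWeakFlow.deriv_cutoffMass (h : IsWeakFlow V J U G) (ht₀ : t₀ ∈ J)
    (hζ : IsCutoffProfile ζ) (hR : 0 < R) {M : ℝ} (hM : ∀ t ∈ J, mass (U t) = M)
    (hd : DifferentiableAt ℝ (fun t => cutoffMass ζ R (U t)) t₀) :
    deriv (fun t => cutoffMass ζ R (U t)) t₀ =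
      2 / R * (∫ x, ζ (x / R) • (G t₀ x * starRingEnd ℂ (U t₀ x))).im := by
  -- The complementary weight is compactly supported, and its contribution differs from the
  -- cut-off mass by a conserved quantity.
  let w (x : ℝ) : ℝ := cutoffWeight ζ 2 - cutoffWeight ζ (x / R)
  have hw' (x : ℝ) : HasDerivAt w (-(ζ (x / R) / R)) x := by
    refine (((hζ.hasDerivAt_cutoffWeight (x / R)).comp x
      ((hasDerivAt_id x).div_const R)).const_sub (cutoffWeight ζ 2)).congr_deriv ?_
    rw [mul_one_div]
  have hderiv : deriv w = fun x => -(ζ (x / R) / R) := funext fun x => (hw' x).deriv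
  have hw : ContDiff ℝ 1 w := by
    refine contDiff_one_iff_deriv.mpr ⟨fun x => (hw' x).differentiableAt, ?_⟩
    rw [hderiv]
    exact ((hζ.continuous.comp (continuous_id.div_const R)).div_const R).neg
  have hc : HasCompactSupport w := hasCompactSupport_of_forall_abs_ge (a := 2 * R) fun x hx => by
    refine sub_eq_zero.mpr (hζ.cutoffWeight_eq ?_).symm
    rwa [abs_div, abs_of_pos hR, le_div_iff₀ hR]
  have hsplit : ∀ᶠ t in 𝓝 t₀,
      ∫ x, w x * ‖U t x‖ ^ 2 = cutoffWeight ζ 2 * M - cutoffMass ζ R (U t) := by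
    filter_upwards [h.eventually_mem ht₀] with t ht
    have hU := (h.isH1Pair t ht).memLp
    rw [← hM t ht, mass, cutoffMass, ← integral_const_mul, ← integral_sub
      ((hU.integrable_norm_pow two_ne_zero).const_mul _) (hζ.integrable_cutoffWeight_mul hU R)]
    simp only [w, sub_mul]
  have hw_deriv := (hd.hasDerivAt.const_sub (cutoffWeight ζ 2 * M)).congr_of_eventuallyEq hsplit
  have hflux := h.deriv_integral_mul_norm_sq ht₀ hw hc
    (fun x => sub_nonneg.mpr (hζ.cutoffWeight_le _)) hw_deriv.differentiableAt
  rw [hw_deriv.deriv, hderiv] at hflux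
  have hscale (x : ℝ) : G t₀ x * (((-(ζ (x / R) / R) : ℝ) : ℂ) * starRingEnd ℂ (U t₀ x)) =
      -R⁻¹ • ζ (x / R) • (G t₀ x * starRingEnd ℂ (U t₀ x)) := by
    simp only [Complex.real_smul]
    push_cast
    ring
  simp only [hscale, integral_smul, Complex.smul_im, smul_eq_mul] at hflux
  linear_combination -hflux

theorem IsWeakFlow.deriv_virial (h : IsWeakFlow V J U G) (ht₀ : t₀ ∈ J)
    (hae : ∀ t ∈ J, u t =ᵐ[volume] U t) (hζ : IsCutoffProfile ζ) (hR : 0 < R) {M : ℝ}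
    (hM : ∀ t ∈ J, mass (u t) = M)
    (hd : DifferentiableAt ℝ (virial (fun x => R * ζ (x / R)) u) t₀) :
    deriv (virial (fun x => R * ζ (x / R)) u) t₀ =
      2 * R * (∫ x, ζ (x / R) • (G t₀ x * starRingEnd ℂ (U t₀ x))).im := by
  have hcutoff : (fun t => cutoffMass ζ R (U t)) =ᶠ[𝓝 t₀]
      fun t => (R ^ 2)⁻¹ * virial (fun x => R * ζ (x / R)) u t := by
    filter_upwards [h.eventually_mem ht₀] with t ht
    rw [virial_comp_div hR.ne', cutoffMass_congr_ae (hae t ht),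
      inv_mul_cancel_left₀ (pow_ne_zero 2 hR.ne')]
  have hderiv := (hd.hasDerivAt.const_mul (R ^ 2)⁻¹).congr_of_eventuallyEq hcutoff
  have hflux := h.deriv_cutoffMass ht₀ hζ hR (fun t ht => (mass_congr_ae (hae t ht)).symm.trans
    (hM t ht)) hderiv.differentiableAt
  rw [hderiv.deriv] at hflux
  field_simp at hflux
  linear_combination hflux

theorem IsCutoffProfile.tendsto_cutoffMass_add_sq (hζ : IsCutoffProfile ζ) (hf : MemLp f 2)
    (hf' : Integrable f') (c : ℝ) :
    Tendsto (fun R => cutoffMass ζ R f + (2 * (∫ x, ζ (x / R) • f' x).im) ^ 2 / c) atTop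
      (𝓝 0) := by
  have him := (Complex.continuous_im.tendsto 0).comp (hζ.tendsto_integral_comp_div_smul hf')
  simpa using (hζ.tendsto_cutoffMass hf).add (((him.const_mul 2).pow 2).div_const c)

theorem IsSolution.not_Ici_subset_and_not_Iic_subset {u₀ : ℝ → ℂ} {M E : ℝ}
    (hu : IsSolution V u₀ J u) (hJ : IsOpen J) (hζ : IsCutoffProfile ζ)
    (hV : Integrable fun x => V x * decay x)
    (hcons : ∀ t ∈ J, mass (u t) = M ∧ Integrable (fun x => V x * ‖u t x‖ ^ 2) ∧
      energy V (u t) = E)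
    (hvirial : LocalizedVirialIdentity V J u)
    (hsign : ∀ R : ℝ, 0 < R → ∀ᵐ x,
      -R * deriv (cutoffWeight ζ) (x / R) * deriv V x - 4 * V x ≤ 0)
    (hE : E < 0) : ¬Ici 0 ⊆ J ∧ ¬Iic 0 ⊆ J := by
  obtain ⟨U, hU, hae⟩ := hu.exists_isWeakFlow hJ hV
  obtain ⟨ζ₁, ζ₂, ζ₃, hW⟩ := hζ.memW3Inf
  have hU₀ := hU.isH1Pair 0 hu.zero_mem
  have hcurrent : Integrable fun x => weakDeriv (u 0) x * starRingEnd ℂ (U 0 x) :=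
    hU₀.memLp_deriv.integrable_mul (q := 2) (MemLp.star hU₀.memLp)
  obtain ⟨a, ha, hflux⟩ := hζ.exists_eventually_virialFlux_comp_div_le hW hE M hsign
  obtain ⟨R, hfluxR, hR, hsmall⟩ := (hflux.and ((eventually_gt_atTop 0).and
    ((hζ.tendsto_cutoffMass_add_sq hU₀.memLp hcurrent
      (2 * (-8 * E))).eventually_lt_const ha))).exists
  have hidentity := hvirial _ _ _ _ (hW.comp_div hR.ne') (hζ.hasCompactSupport_comp_div hR)
  have hI (t : ℝ) (ht : t ∈ J) := (hidentity t ht).2.1.hasDerivAt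
  have hI₁ (t : ℝ) (ht : t ∈ J) := (hidentity t ht).2.2
  have hnonneg (t : ℝ) : 0 ≤ virial (fun x => R * ζ (x / R)) u t := by
    rw [virial_comp_div hR.ne']
    exact mul_nonneg (sq_nonneg R) (hζ.cutoffMass_nonneg R _)
  have hconcave (t : ℝ) (ht : t ∈ J) (hle : virial (fun x => R * ζ (x / R)) u t ≤ a * R ^ 2) :
      virialFlux V (fun x => R * ζ (x / R)) (fun x => ζ₁ (x / R))
        (fun x => (R ^ 2)⁻¹ * ζ₃ (x / R)) (u t) ≤ -(-8 * E) := by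
    obtain ⟨hmass, hint, henergy⟩ := hcons t ht
    rw [virial_comp_div hR.ne', mul_comm] at hle
    refine (hfluxR _ (hu.memH1 t ht) hmass henergy hint (hidentity t ht).1
      (le_of_mul_le_mul_right hle (by positivity))).trans_eq (by ring)
  have hinitial : virial (fun x => R * ζ (x / R)) u 0 +
      deriv (virial (fun x => R * ζ (x / R)) u) 0 ^ 2 / (2 * (-8 * E)) < a * R ^ 2 := by
    rw [hU.deriv_virial hu.zero_mem hae hζ hR (fun t ht => (hcons t ht).1)
      (hidentity 0 hu.zero_mem).2.1, virial_comp_div hR.ne',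
      cutoffMass_congr_ae (hae 0 hu.zero_mem)]
    refine (mul_lt_mul_of_pos_right hsmall (pow_pos hR 2)).trans_eq' ?_
    ring
  exact ⟨not_Ici_subset_of_deriv_deriv_le (by linarith) hnonneg hI hI₁ hconcave hinitial,
    not_Iic_subset_of_deriv_deriv_le (by linarith) hnonneg hI hI₁ hconcave hinitial⟩

end CutoffMass

end NLS

/-- The potential enters through pairings of `V u` with test functions, hence the integrability of
`V` against `(1 + x ^ 2) ^ (-2)` in place of local well-posedness. -/
theorem mainTheorem4_general
    (V : ℝ → ℝ) (_hV : ∀ᵐ x, DifferentiableAt ℝ V x)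
    (hVdecay : Integrable fun x => V x * NLS.decay x)
    (ζ : ℝ → ℝ) (hζ : NLS.IsCutoffProfile ζ)
    (u₀ : ℝ → ℂ) (_hu₀ : NLS.MemH1 u₀)
    (Tmin Tmax : EReal) (u : ℝ → ℝ → ℂ)
    (hu : NLS.IsSolution V u₀ (NLS.timeInterval Tmin Tmax) u)
    (hmin : Tmin ≠ ⊥ → NLS.NormBlowsUpAtMin Tmin u)
    (hmax : Tmax ≠ ⊤ → NLS.NormBlowsUpAtMax Tmax u)
    (hcons : ∀ t ∈ NLS.timeInterval Tmin Tmax, NLS.mass (u t) = NLS.mass u₀ ∧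
      Integrable (fun x => V x * ‖u t x‖ ^ 2) ∧ NLS.energy V (u t) = NLS.energy V u₀)
    (hVirial : NLS.LocalizedVirialIdentity V (NLS.timeInterval Tmin Tmax) u)
    (hSign : ∀ R : ℝ, 0 < R → ∀ᵐ x,
      -R * deriv (NLS.cutoffWeight ζ) (x / R) * deriv V x - 4 * V x ≤ 0)
    (hE : NLS.energy V u₀ < 0) :
    NLS.BlowsUp Tmin Tmax u := by
  obtain ⟨hIci, hIic⟩ := hu.not_Ici_subset_and_not_Iic_subset
    (NLS.isOpen_timeInterval Tmin Tmax) hζ hVdecay hcons hVirial hSign hE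
  have hTmin : Tmin ≠ ⊥ := by
    rintro rfl
    exact hIic fun t ht =>
      ⟨EReal.bot_lt_coe t, (EReal.coe_le_coe_iff.mpr ht).trans_lt hu.zero_mem.2⟩
  have hTmax : Tmax ≠ ⊤ := by
    rintro rfl
    exact hIci fun t ht =>
      ⟨hu.zero_mem.1.trans_le (EReal.coe_le_coe_iff.mpr ht), EReal.coe_lt_top t⟩
  exact ⟨⟨hTmin, hmin hTmin⟩, ⟨hTmax, hmax hTmax⟩⟩

theorem mainTheorem4
    (V : ℝ → ℝ) (hV : ∀ᵐ x, DifferentiableAt ℝ V x)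
    (ζ : ℝ → ℝ) (hζ : NLS.IsCutoffProfile ζ)
    (u₀ : ℝ → ℂ) (hu₀ : NLS.MemH1 u₀)
    (hLWP : NLS.LocallyWellPosed V)
    (Tmin Tmax : EReal) (u : ℝ → ℝ → ℂ)
    (hu : NLS.IsMaximalSolution V u₀ Tmin Tmax u)
    (hVirial : NLS.LocalizedVirialIdentity V (NLS.timeInterval Tmin Tmax) u)
    (hSign : ∀ R : ℝ, 0 < R → ∀ᵐ x,
      -R * deriv (NLS.cutoffWeight ζ) (x / R) * deriv V x - 4 * V x ≤ 0)
    (hE : NLS.energy V u₀ < 0) :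
    NLS.BlowsUp Tmin Tmax u := by
  obtain ⟨hmin, hmax, hcons⟩ := hu.blowUp_and_conservation hu₀ hLWP
  exact mainTheorem4_general V hV hLWP.integrable_mul_decay ζ hζ u₀ hu₀ Tmin Tmax u hu.isSolution
    hmin hmax hcons hVirial hSign hE
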